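/- Let $\mathbb{K}$ be a field of characteristic zero. A (central hyperplane) arrangement $(\mathscr{A},V)$ is a finite set $\mathscr{A}$ of linear hyperplanes (subspaces of codimension one) in a finite-dimensional $\mathbb{K}$-vector space $V$. For $H\in\mathscr{A}$ let $\alpha_H\in V^*$ be a linear form with kernel $H$. Choose a basis $x_1,\dots,x_\ell$ of $V^*$, let $S=\mathrm{Sym}(V^*)=\mathbb{K}[x_1,\dots,x_\ell]$, and put $Q=\prod_{H\in\mathscr{A}}\alpha_H\in S$. For $m\ge 0$ let $$D^{(m)}(S)=\bigoplus_{|a|=m}S\,\partial^{a}\subseteq \mathrm{End}_{\mathbb{K}}(S),\qquad \partial^{a}=\partial_1^{a_1}\cdots\partial_\ell^{a_\ell},\quad \partial_i=\frac{\partial}{\partial x_i},$$ where $S$ acts on $\mathrm{End}_{\mathbb{K}}(S)$ by multiplication from the left, and let $$D^{(m)}(\mathscr{A})=\{\theta\in D^{(m)}(S)\mid \theta(QS)\subseteq QS\}.$$ The arrangement $(\mathscr{A},V)$ is called $m$-free if $D^{(m)}(\mathscr{A})$ is a free $S$-module (this does not depend on the choice of the forms $\alpha_H$ and of the basis). Let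 $(\mathscr{A}_1,V_1)$ and $(\mathscr{A}_2,V_2)$ be arrangements over $\mathbb{K}$ with $\dim V_1>0$ and $\dim V_2>0$, and let $$\mathscr{A}_1\times\mathscr{A}_2=\{H\oplus V_2\mid H\in\mathscr{A}_1\}\cup\{V_1\oplus H\mid H\in\mathscr{A}_2\}$$ be the product arrangement in $V_1\oplus V_2$. Then for every integer $m\ge 0$ the following are equivalent: 1. $(\mathscr{A}_1\times\mathscr{A}_2,V_1\oplus V_2)$ is $m$-free; 2. both $(\mathscr{A}_1,V_1)$ and $(\mathscr{A}_2,V_2)$ are $i$-free for all $1\le i\le m$; 3. $(\mathscr{A}_1\times\mathscr{A}_2,V_1\oplus V_2)$ is $i$-free for all $1\le i\le m$. -/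

import Mathlib

open MvPolynomial

noncomputable section

/-- A central hyperplane arrangement in `V`: a finite collection of hyperplanes through the origin,
that is, of linear subspaces of codimension one (maximal proper subspaces). -/
structure CentralArrangement (K V : Type*) [Field K] [AddCommGroup V] [Module K V] where
  hyperplanes : Finset (Submodule K V)
  isCoatom : ∀ H ∈ hyperplanes, IsCoatom H

/-- A linear form `α_H` with `{α_H = 0} = H` (for a hyperplane `H`; see `ker_definingForm`). -/
def definingForm {K V : Type*} [Field K] [AddCommGroup V] [Module K V]
    (H : Submodule K V) : Module.Dual K V :=
  Classical.epsilon fun α : Module.Dual K V => LinearMap.ker α = H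

theorem ker_definingForm {K V : Type*} [Field K] [AddCommGroup V] [Module K V]
    {H : Submodule K V} (hH : IsCoatom H) : LinearMap.ker (definingForm H) = H := by
  have h : ∃ α : Module.Dual K V, LinearMap.ker α = H := by
    obtain ⟨f, hf, hle⟩ := Submodule.exists_le_ker_of_lt_top H hH.lt_top
    refine ⟨f, ?_⟩
    rcases hH.le_iff.1 hle with h | h
    · exact absurd (LinearMap.ker_eq_top.1 h) hf
    · exact h
  exact Classical.epsilon_spec h

/-- The partial derivative `∂_i` as an element of the endomorphism ring `End_K(S)`,
`S = K[x_i : i ∈ ι]`. -/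
def partialOp (K : Type*) {ι : Type*} [Field K] (i : ι) : Module.End K (MvPolynomial ι K) :=
  (pderiv i : Derivation K (MvPolynomial ι K) (MvPolynomial ι K))

theorem commute_partialOp (K : Type*) {ι : Type*} [Field K] (i j : ι) :
    Commute (partialOp K i) (partialOp K j) := by
  classical
  have h : ⁅(pderiv i : Derivation K (MvPolynomial ι K) (MvPolynomial ι K)),
      (pderiv j : Derivation K (MvPolynomial ι K) (MvPolynomial ι K))⁆ = 0 := by
    apply MvPolynomial.derivation_ext
    intro k
    rw [Derivation.commutator_apply]
    simp only [pderiv_X, Pi.single_apply, Derivation.coe_zero, Pi.zero_apply]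
    split_ifs <;> simp
  refine LinearMap.ext fun f => ?_
  have hf := DFunLike.congr_fun h f
  rw [Derivation.commutator_apply, Derivation.coe_zero, Pi.zero_apply, sub_eq_zero] at hf
  exact hf

/-- The operator `∂^a = ∏ ∂_i ^ a_i` in `End_K(S)` for a multi-index `a`; the product is
composition, and the factors commute. -/
def partialPow (K : Type*) {ι : Type*} [Field K] (a : ι →₀ ℕ) :
    Module.End K (MvPolynomial ι K) :=
  a.support.noncommProd (fun i => partialOp K i ^ a i)
    fun i _ j _ _ => (commute_partialOp K i j).pow_pow (a i) (a j)

/-- `D^(m)(S) = ⊕_{|a| = m} S ∂^a`, the `S`-submodule of `End_K(S)` generated by the operators `∂^a`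
with `|a| = m`, where `S` acts by multiplication from the left, `(f • θ) g = f * θ g`. -/
def diffOps (K ι : Type*) [Field K] (m : ℕ) :
    Submodule (MvPolynomial ι K) (Module.End K (MvPolynomial ι K)) :=
  Submodule.span (MvPolynomial ι K)
    {θ | ∃ a : ι →₀ ℕ, a.degree = m ∧ θ = partialPow K a}

namespace CentralArrangement

/-- The defining polynomial `Q(A) = ∏ α_H` in `S = Sym(V^*) = K[x_i : i ∈ ι]`, where `x` is a basis
of the dual space `V^*`; the linear form `α = ∑ c_i x_i` is the polynomial `∑ c_i X_i`. -/
def definingPolynomial {K V ι : Type*} [Field K] [AddCommGroup V] [Module K V]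
    (A : CentralArrangement K V) (x : Module.Basis ι K (Module.Dual K V)) : MvPolynomial ι K :=
  ∏ H ∈ A.hyperplanes, x.constr K (fun i => (X i : MvPolynomial ι K)) (definingForm H)

/-- `D^(m)(A) = {θ ∈ D^(m)(S) | θ(QS) ⊆ QS}`, the module of `m`-th order `A`-differential
operators. -/
def diffOps {K V ι : Type*} [Field K] [AddCommGroup V] [Module K V]
    (A : CentralArrangement K V) (x : Module.Basis ι K (Module.Dual K V)) (m : ℕ) :
    Submodule (MvPolynomial ι K) (Module.End K (MvPolynomial ι K)) where
  carrier := {θ | θ ∈ _root_.diffOps K ι m ∧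
    ∀ g ∈ Ideal.span {A.definingPolynomial x}, θ g ∈ Ideal.span {A.definingPolynomial x}}
  zero_mem' := ⟨Submodule.zero_mem _, fun _ _ => Submodule.zero_mem _⟩
  add_mem' := fun hθ hη =>
    ⟨Submodule.add_mem _ hθ.1 hη.1, fun g hg => Submodule.add_mem _ (hθ.2 g hg) (hη.2 g hg)⟩
  smul_mem' := fun f _ hθ =>
    ⟨Submodule.smul_mem _ f hθ.1, fun g hg => Ideal.mul_mem_left _ f (hθ.2 g hg)⟩

/-- `A` is `m`-free if `D^(m)(A)` is a free `S`-module. The symmetric algebra `S` of `V^*` is written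
in the coordinates given by a basis `x` of `V^*`. -/
def IsMFree {K V ι : Type*} [Field K] [AddCommGroup V] [Module K V]
    (A : CentralArrangement K V) (x : Module.Basis ι K (Module.Dual K V)) (m : ℕ) : Prop :=
  Module.Free (MvPolynomial ι K) (A.diffOps x m)

open Classical in
/-- The product arrangement `A₁ × A₂ = {H ⊕ V₂ | H ∈ A₁} ∪ {V₁ ⊕ H | H ∈ A₂}` in `V₁ ⊕ V₂`. -/
def prod {K V₁ V₂ : Type*} [Field K] [AddCommGroup V₁] [Module K V₁]
    [AddCommGroup V₂] [Module K V₂]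
    (A₁ : CentralArrangement K V₁) (A₂ : CentralArrangement K V₂) :
    CentralArrangement K (V₁ × V₂) where
  hyperplanes :=
    A₁.hyperplanes.image (fun H => H.prod (⊤ : Submodule K V₂)) ∪
      A₂.hyperplanes.image (fun H => (⊤ : Submodule K V₁).prod H)
  isCoatom := by
    intro H hH
    rcases Finset.mem_union.1 hH with h | h
    · obtain ⟨H₁, h₁, rfl⟩ := Finset.mem_image.1 h
      rw [← Submodule.comap_fst]
      exact (Submodule.isCoatom_comap_iff LinearMap.fst_surjective).2 (A₁.isCoatom H₁ h₁)
    · obtain ⟨H₂, h₂, rfl⟩ := Finset.mem_image.1 h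
      rw [← Submodule.comap_snd]
      exact (Submodule.isCoatom_comap_iff LinearMap.snd_surjective).2 (A₂.isCoatom H₂ h₂)

end CentralArrangement

end

/-! Write an operator in normal order, coefficients to the left of derivatives. In characteristic
zero this identifies polynomial differential operators with polynomials in doubled variables, their
symbols (`symOp`, `symOp_injective`). Order and coefficient degree become weights on these symbols,
and splitting the coordinates into two groups becomes a tensor product decomposition.

The core is `symPres_pair`: for `Q = Q₁Q₂` in disjoint variables, the symbols of order `m`
preserving `(Q)` are the sum over `i` of the products of symbols of order `i` preserving `(Q₁)` and
symbols of order `m - i` preserving `(Q₂)`. An operator preserving `(Q₁Q₂)` preserves `(Q₁)`, since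
`Q₂` is a nonzerodivisor modulo `Q₁` and commutators lower the order (`IsDiffOp.dvd_of_dvd_mul`).
Then each coefficient of its symbol with respect to the second group of variables preserves `(Q₁)`
as well (`Preserves.coeffRight`), because the commutator with `x_i` differentiates the symbol by the
variable standing for `∂_i`.

If all factors are free up to order `m`, products of basis elements form a basis for the product
(`presOps_pair_free`). Conversely, multiplication by a fixed nonzero symbol `G` of order `m - i`
embeds the order `i` module of one factor into the order `m` module of the product, and taking a
coefficient of the second variables splits this embedding. A free module over the large polynomial
ring is free over the small one, so the factor is projective (`presOps_projective_of_free_pair`). It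
is graded by coefficient degree since `Q₁` is homogeneous, and a graded projective module is free
(`free_of_projective_of_graded`). Order zero is always free, and the third condition follows from
the other two. -/

noncomputable section

/-! ### Iterated partial derivatives -/

section PartialPow

variable {K σ : Type*} [Field K]

theorem partialPow_add (a b : σ →₀ ℕ) :
    partialPow K (a + b) = partialPow K a * partialPow K b := by
  -- The commuting `∂_i` generate a commutative submonoid, in which the noncommutative product is an
  -- ordinary one.
  let C := Submonoid.closure (Set.range (partialOp K : σ → _))
  have hC := Submonoid.isMulCommutative_closure _ (s := Set.range (partialOp K : σ → _)) (by
    rintro _ ⟨i, rfl⟩ _ ⟨j, rfl⟩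
    exact commute_partialOp K i j)
  let _ : CommMonoid C :=
    { (inferInstance : Monoid C) with mul_comm := fun a b => hC.is_comm.comm a b }
  let g : σ → C := fun i => ⟨partialOp K i, Submonoid.subset_closure ⟨i, rfl⟩⟩
  have h : ∀ a : σ →₀ ℕ, partialPow K a = C.subtype (a.prod fun i n => g i ^ n) := by
    intro a
    have h₁ := Finset.map_noncommProd a.support (fun i => g i ^ a i)
      (fun _ _ _ _ _ => Commute.all _ _) C.subtype
    rw [Finset.noncommProd_eq_prod] at h₁
    exact h₁.symm
  rw [h, h, h, ← map_mul, Finsupp.prod_add_index']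
  · intro i; exact pow_zero _
  · intro i m n; exact pow_add _ _ _

@[simp] theorem partialPow_zero : partialPow K (0 : σ →₀ ℕ) = 1 := by
  simp [partialPow]

@[simp] theorem partialPow_single (i : σ) : partialPow K (Finsupp.single i 1) = partialOp K i := by
  classical
  have h : (Finsupp.single i 1 : σ →₀ ℕ).support = {i} := Finsupp.support_single _ one_ne_zero
  rw [partialPow]
  refine (Finset.noncommProd_congr h (fun _ _ => rfl) _).trans ?_
  refine (Finset.noncommProd_singleton _ _).trans ?_
  simp

/-- The truncated subtraction is harmless: if `a.degree > n`, the derivative vanishes and is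
homogeneous of every degree. -/
theorem isHomogeneous_partialPow {f : MvPolynomial σ K} {n : ℕ} (hf : f.IsHomogeneous n)
    (a : σ →₀ ℕ) : (partialPow K a f).IsHomogeneous (n - a.degree) := by
  induction a using Finsupp.induction_linear generalizing f n with
  | zero => simpa using hf
  | add a b ha hb =>
    rw [partialPow_add, Module.End.mul_apply, map_add, add_comm, ← Nat.sub_sub]
    exact ha (hb hf)
  | single i k =>
    induction k generalizing f n with
    | zero => simpa using hf
    | succ k ih =>
      rw [Finsupp.single_add, partialPow_add, partialPow_single, Module.End.mul_apply]
      simp only [map_add, Finsupp.degree_single]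
      rw [add_comm, ← Nat.sub_sub]
      have := ih (f := partialOp K i f) (n := n - 1) hf.pderiv
      simpa using this

end PartialPow

/-! ### Normally ordered symbols of differential operators -/

section SymOp

variable {K σ : Type*} [Field K]

/-- The normally ordered differential operator with a given symbol: in the symbol,
`X (inl i)` stands for `x_i` and `X (inr i)` for `∂_i`. -/
def symOp : MvPolynomial (σ ⊕ σ) K →ₗ[K] Module.End K (MvPolynomial σ K) :=
  (basisMonomials (σ ⊕ σ) K).constr K fun w =>
    (monomial (Finsupp.sumFinsuppAddEquivProdFinsupp w).1 (1 : K)) •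
      partialPow K (Finsupp.sumFinsuppAddEquivProdFinsupp w).2

theorem symOp_monomial (w : σ ⊕ σ →₀ ℕ) (c : K) :
    symOp (monomial w c) = (monomial (Finsupp.sumFinsuppAddEquivProdFinsupp w).1 c) •
      partialPow K (Finsupp.sumFinsuppAddEquivProdFinsupp w).2 := by
  have h : (monomial w c : MvPolynomial (σ ⊕ σ) K) = c • basisMonomials (σ ⊕ σ) K w := by
    simp [smul_monomial]
  rw [h, map_smul, symOp, Module.Basis.constr_basis, ← smul_assoc, smul_monomial, smul_eq_mul,
    mul_one]

theorem sumFinsupp_single_inl (i : σ) :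
    Finsupp.sumFinsuppAddEquivProdFinsupp (Finsupp.single (Sum.inl i) 1 : σ ⊕ σ →₀ ℕ) =
      (Finsupp.single i 1, 0) := by
  classical
  ext j <;> simp [Finsupp.single_apply]

theorem sumFinsupp_single_inr (i : σ) :
    Finsupp.sumFinsuppAddEquivProdFinsupp (Finsupp.single (Sum.inr i) 1 : σ ⊕ σ →₀ ℕ) =
      (0, Finsupp.single i 1) := by
  classical
  ext j <;> simp [Finsupp.single_apply]

theorem symOp_mul_X_inl (F : MvPolynomial (σ ⊕ σ) K) (i : σ) :
    symOp (F * X (Sum.inl i)) = (X i : MvPolynomial σ K) • symOp F := by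
  induction F using MvPolynomial.induction_on' with
  | monomial w c =>
    rw [X, monomial_mul, symOp_monomial, symOp_monomial, map_add, sumFinsupp_single_inl,
      ← smul_assoc]
    simp [X, monomial_mul, add_comm]
  | add p q hp hq => rw [add_mul, map_add, hp, hq, map_add, smul_add]

theorem symOp_mul_X_inr (F : MvPolynomial (σ ⊕ σ) K) (i : σ) :
    symOp (F * X (Sum.inr i)) = symOp F * partialOp K i := by
  induction F using MvPolynomial.induction_on' with
  | monomial w c =>
    rw [X, monomial_mul, symOp_monomial, symOp_monomial, map_add, sumFinsupp_single_inr]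
    simp only [Prod.snd_add, Prod.fst_add, add_zero, partialPow_add, partialPow_single,
      smul_mul_assoc, mul_one]
  | add p q hp hq => rw [add_mul, map_add, hp, hq, map_add, add_mul]

theorem symOp_C (c : K) : symOp (C c : MvPolynomial (σ ⊕ σ) K) = c • 1 := by
  rw [C_apply, symOp_monomial]
  refine LinearMap.ext fun f => ?_
  simp [C_mul']

theorem symOp_rename_inl_mul (f : MvPolynomial σ K) (F : MvPolynomial (σ ⊕ σ) K) :
    symOp (rename Sum.inl f * F) = f • symOp F := by
  induction f using MvPolynomial.induction_on generalizing F with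
  | C c => rw [rename_C, C_mul', map_smul]
           exact LinearMap.ext fun g => by simp [C_mul']
  | add p q hp hq => rw [map_add, add_mul, map_add, hp, hq, add_smul]
  | mul_X p i hp =>
    rw [map_mul (rename Sum.inl), mul_assoc, hp, rename_X, mul_comm (X (Sum.inl i)),
      symOp_mul_X_inl, ← smul_assoc, smul_eq_mul]

theorem symOp_rename_inr_monomial (a : σ →₀ ℕ) :
    symOp (rename Sum.inr (monomial a (1 : K))) = partialPow K a := by
  classical
  rw [rename_monomial, symOp_monomial]
  have : Finsupp.sumFinsuppAddEquivProdFinsupp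
      (Finsupp.mapDomain (Sum.inr : σ → σ ⊕ σ) a) = (0, a) := by
    ext j
    · simp only [Finsupp.fst_sumFinsuppAddEquivProdFinsupp]
      exact Finsupp.mapDomain_of_notMem_range _ _ (by simp)
    · simp only [Finsupp.snd_sumFinsuppAddEquivProdFinsupp]
      exact Finsupp.mapDomain_apply Sum.inr_injective _ _
  rw [this]
  simp

/-- By the Leibniz rule, the commutator of an operator with `x_i` has as symbol the derivative of
its symbol in the variable for `∂_i`. All inductions on the order of a symbol rest on this. -/
theorem symOp_X_mul (F : MvPolynomial (σ ⊕ σ) K) (i : σ) (f : MvPolynomial σ K) :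
    symOp F (X i * f) = X i * symOp F f + symOp (pderiv (Sum.inr i) F) f := by
  classical
  induction F using MvPolynomial.induction_on generalizing f with
  | C c => simp [symOp_C]
  | add p q hp hq => simp only [map_add, LinearMap.add_apply, hp, hq]; ring
  | mul_X p j hp =>
    rcases j with j | j
    · rw [symOp_mul_X_inl, Derivation.leibniz, pderiv_X_of_ne (by simp), smul_zero, zero_add,
        smul_eq_mul, mul_comm (X (Sum.inl j)), symOp_mul_X_inl]
      simp only [LinearMap.smul_apply, smul_eq_mul, hp]
      ring
    · rw [symOp_mul_X_inr, Derivation.leibniz, map_add, smul_eq_mul, smul_eq_mul,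
        mul_comm (X (Sum.inr j)), symOp_mul_X_inr]
      simp only [Module.End.mul_apply, LinearMap.add_apply]
      have h : partialOp K j (X i * f) =
          X i * partialOp K j f + (if j = i then f else 0) := by
        simp only [partialOp, Derivation.coeFn_coe, Derivation.leibniz, smul_eq_mul, pderiv_X,
          Pi.single_apply]
        by_cases hij : j = i
        · subst hij; simp
        · simp [hij, Ne.symm hij]
      rw [h, map_add, hp, pderiv_X, Pi.single_apply]
      simp only [Sum.inr.injEq]
      by_cases hij : j = i
      · subst hij; simp; ring
      · simp [hij]

/-- Every `∂_i` kills `1`, so only the terms free of derivatives survive. -/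
theorem symOp_one_eq (F : MvPolynomial (σ ⊕ σ) K) :
    symOp F 1 = aeval (Sum.elim X 0) F := by
  induction F using MvPolynomial.induction_on with
  | C c => simp [symOp_C, ← C_mul']
  | add p q hp hq => simp [hp, hq]
  | mul_X p j hp =>
    rcases j with j | j
    · rw [symOp_mul_X_inl]; simp [hp, mul_comm]
    · rw [symOp_mul_X_inr]; simp [partialOp]

end SymOp

/-! ### Polynomials in two groups of variables -/

section Split

open TensorProduct

variable {K α β γ : Type*} [Field K]

/-- The isomorphism `K[α] ⊗ K[β] ≃ K[γ]` for a partition `e` of the variables. -/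
def splitEquiv (K : Type*) [Field K] (e : α ⊕ β ≃ γ) :
    MvPolynomial α K ⊗[K] MvPolynomial β K ≃ₐ[K] MvPolynomial γ K :=
  (tensorEquivSum K α β K).trans (renameEquiv K e)

/-- The product of a polynomial in the first and a polynomial in the second variables. -/
def pair (e : α ⊕ β ≃ γ) : MvPolynomial α K →ₗ[K] MvPolynomial β K →ₗ[K] MvPolynomial γ K :=
  (TensorProduct.mk K _ _).compr₂ (splitEquiv K e).toLinearMap

theorem splitEquiv_tmul (e : α ⊕ β ≃ γ) (p : MvPolynomial α K) (q : MvPolynomial β K) :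
    splitEquiv K e (p ⊗ₜ q) = pair e p q := rfl

theorem pair_apply (e : α ⊕ β ≃ γ) (p : MvPolynomial α K) (q : MvPolynomial β K) :
    pair e p q = rename (e ∘ Sum.inl) p * rename (e ∘ Sum.inr) q := by
  have h : ((splitEquiv K e : _ →ₐ[K] _)) =
      Algebra.TensorProduct.productMap (rename (e ∘ Sum.inl)) (rename (e ∘ Sum.inr)) := by
    ext i <;> simp [splitEquiv]
  have := DFunLike.congr_fun h (p ⊗ₜ q)
  exact this.trans (by simp)

theorem pair_mul_pair (e : α ⊕ β ≃ γ) (p p' : MvPolynomial α K) (q q' : MvPolynomial β K) :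
    pair e p q * pair e p' q' = pair e (p * p') (q * q') := by
  simp only [pair_apply, map_mul]; ring

theorem pair_comm (e : α ⊕ β ≃ γ) (p : MvPolynomial α K) (q : MvPolynomial β K) :
    pair ((Equiv.sumComm β α).trans e) q p = pair e p q := by
  simp only [pair_apply]
  rw [mul_comm]
  rfl

theorem pair_one_right (e : α ⊕ β ≃ γ) (p : MvPolynomial α K) :
    pair e p 1 = rename (e ∘ Sum.inl) p := by simp [pair_apply]

theorem pair_one_left (e : α ⊕ β ≃ γ) (q : MvPolynomial β K) :
    pair e 1 q = rename (e ∘ Sum.inr) q := by simp [pair_apply]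

theorem pair_induction (e : α ⊕ β ≃ γ) {P : MvPolynomial γ K → Prop} (f : MvPolynomial γ K)
    (hpair : ∀ p q, P (pair e p q)) (hadd : ∀ f g, P f → P g → P (f + g)) : P f := by
  obtain ⟨t, rfl⟩ := (splitEquiv K e).surjective f
  induction t using TensorProduct.induction_on with
  | zero => simpa using hpair 0 0
  | tmul p q => exact hpair p q
  | add x y hx hy => rw [map_add]; exact hadd _ _ hx hy

theorem pair_linearIndependent (e : α ⊕ β ≃ γ) {κ κ' : Type*} {u : κ → MvPolynomial α K}
    {w : κ' → MvPolynomial β K} (hu : LinearIndependent K u) (hw : LinearIndependent K w) :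
    LinearIndependent K fun i : κ × κ' => pair e (u i.1) (w i.2) :=
  (LinearIndependent.tmul_of_isDomain hu hw).map' (splitEquiv K e).toLinearMap
    (LinearMap.ker_eq_bot.2 (splitEquiv K e).injective)

/-- The endomorphism of `K[γ]` acting on the second variables by `q`. -/
def mapRight (e : α ⊕ β ≃ γ) (q : MvPolynomial β K →ₗ[K] MvPolynomial β K) :
    MvPolynomial γ K →ₗ[K] MvPolynomial γ K :=
  (splitEquiv K e).toLinearMap ∘ₗ (q.lTensor (MvPolynomial α K)) ∘ₗ
    (splitEquiv K e).symm.toLinearMap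

theorem mapRight_pair (e : α ⊕ β ≃ γ) (q : MvPolynomial β K →ₗ[K] MvPolynomial β K)
    (f : MvPolynomial α K) (g : MvPolynomial β K) : mapRight e q (pair e f g) = pair e f (q g) := by
  simp only [mapRight, ← splitEquiv_tmul, LinearMap.comp_apply, AlgEquiv.toLinearMap_apply,
    AlgEquiv.symm_apply_apply, LinearMap.lTensor_tmul]

/-- The coefficient of a monomial in the second variables. -/
def coeffRight (e : α ⊕ β ≃ γ) (c : β →₀ ℕ) : MvPolynomial γ K →ₗ[K] MvPolynomial α K :=
  (TensorProduct.rid K _).toLinearMap ∘ₗ ((lcoeff K c).lTensor (MvPolynomial α K)) ∘ₗ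
    (splitEquiv K e).symm.toLinearMap

theorem coeffRight_pair (e : α ⊕ β ≃ γ) (c : β →₀ ℕ) (f : MvPolynomial α K)
    (g : MvPolynomial β K) : coeffRight e c (pair e f g) = coeff c g • f := by
  simp [coeffRight, ← splitEquiv_tmul]

theorem coeffRight_rename_mul (e : α ⊕ β ≃ γ) (c : β →₀ ℕ) (p : MvPolynomial α K)
    (f : MvPolynomial γ K) :
    coeffRight e c (rename (e ∘ Sum.inl) p * f) = p * coeffRight e c f := by
  induction f using pair_induction e with
  | hpair f g =>
    rw [← pair_one_right, pair_mul_pair, one_mul, coeffRight_pair, coeffRight_pair, mul_smul_comm]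
  | hadd f g hf hg => rw [mul_add, map_add, hf, hg, map_add, mul_add]

theorem eq_sum_coeffRight (e : α ⊕ β ≃ γ) (f : MvPolynomial γ K) :
    ∃ s : Finset (β →₀ ℕ), ∀ t, s ⊆ t →
      f = ∑ c ∈ t, pair e (coeffRight e c f) (monomial c 1) := by
  classical
  induction f using pair_induction e with
  | hpair f g =>
    refine ⟨g.support, fun t ht => ?_⟩
    simp only [coeffRight_pair]
    rw [← Finset.sum_subset ht]
    · conv_lhs => rw [g.as_sum]
      rw [map_sum]
      refine Finset.sum_congr rfl fun c _ => ?_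
      rw [map_smul, LinearMap.smul_apply, ← map_smul, smul_monomial, smul_eq_mul, mul_one]
    · intro c _ hc
      rw [notMem_support_iff.1 hc, zero_smul, map_zero, LinearMap.zero_apply]
  | hadd f g hf hg =>
    obtain ⟨s, hs⟩ := hf
    obtain ⟨s', hs'⟩ := hg
    refine ⟨s ∪ s', fun t ht => ?_⟩
    simp only [map_add, LinearMap.add_apply, Finset.sum_add_distrib]
    rw [← hs t (Finset.union_subset_left ht), ← hs' t (Finset.union_subset_right ht)]

theorem eq_zero_of_coeffRight (e : α ⊕ β ≃ γ) {f : MvPolynomial γ K}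
    (h : ∀ c, coeffRight e c f = 0) : f = 0 := by
  obtain ⟨s, hs⟩ := eq_sum_coeffRight e f
  rw [hs s subset_rfl]
  simp [h]

theorem pderiv_pair_left (e : α ⊕ β ≃ γ) (i : α) (f : MvPolynomial α K) (g : MvPolynomial β K) :
    pderiv (e (Sum.inl i)) (pair e f g) = pair e (pderiv i f) g := by
  classical
  rw [pair_apply, pair_apply, Derivation.leibniz]
  rw [show e (Sum.inl i) = (e ∘ Sum.inl) i from rfl,
    pderiv_rename (e.injective.comp Sum.inl_injective)]
  have : pderiv ((e ∘ Sum.inl) i) (rename (e ∘ Sum.inr) g) = 0 := by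
    refine pderiv_eq_zero_of_notMem_vars fun h => ?_
    obtain ⟨j, -, hj⟩ := Finset.mem_image.1 (vars_rename _ _ h)
    simp at hj
  rw [this]
  simp [mul_comm]

theorem pderiv_pair_right (e : α ⊕ β ≃ γ) (i : β) (f : MvPolynomial α K) (g : MvPolynomial β K) :
    pderiv (e (Sum.inr i)) (pair e f g) = pair e f (pderiv i g) := by
  rw [← pair_comm e, ← pair_comm e]
  exact pderiv_pair_left ((Equiv.sumComm β α).trans e) i g f

/-- The factor `c i + 1` is invertible in characteristic zero, so the derivative recovers every
coefficient whose exponent involves `i`. -/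
theorem coeffRight_pderiv (e : α ⊕ β ≃ γ) (c : β →₀ ℕ) (i : β) (f : MvPolynomial γ K) :
    coeffRight e c (pderiv (e (Sum.inr i)) f) =
      ((c i : K) + 1) • coeffRight e (c + Finsupp.single i 1) f := by
  classical
  induction f using pair_induction e with
  | hpair f g =>
    rw [pderiv_pair_right, coeffRight_pair, coeffRight_pair, smul_smul]
    congr 1
    induction g using MvPolynomial.induction_on' with
    | monomial w k =>
      rw [pderiv_monomial, coeff_monomial, coeff_monomial]
      by_cases hw : w = c + Finsupp.single i 1
      · subst hw
        simp [mul_comm]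
      · rw [if_neg hw, mul_zero]
        split_ifs with h'
        · subst h'
          by_cases hi : w i = 0
          · simp [hi]
          · exact absurd (tsub_add_cancel_of_le
              (Finsupp.single_le_iff.2 (Nat.one_le_iff_ne_zero.2 hi))).symm hw
        · rfl
    | add p q hp hq =>
      simp only [map_add, coeff_add, mul_add]
      rw [hp, hq]
  | hadd f g hf hg => rw [map_add, map_add, hf, hg, map_add, smul_add]

/-- A tensor with all its partial contractions in given subspaces lies in their tensor product. -/
theorem mem_map₂_pair (e : α ⊕ β ≃ γ) (U : Submodule K (MvPolynomial α K))
    (W : Submodule K (MvPolynomial β K)) {f : MvPolynomial γ K}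
    (hU : ∀ c, coeffRight e c f ∈ U)
    (hW : ∀ d, coeffRight ((Equiv.sumComm β α).trans e) d f ∈ W) :
    f ∈ Submodule.map₂ (pair e) U W := by
  -- A linear projection onto `W`, applied to the second tensor factor, fixes `f` because its slices
  -- there lie in `W`. Expanding `f` along monomials in the second variables then leaves first
  -- factors in `U`, and the projection moves the second factors into `W`.
  obtain ⟨q, hq⟩ := W.subtype.exists_leftInverse_of_injective W.ker_subtype
  have hf : f = mapRight e (W.subtype ∘ₗ q) f := by
    obtain ⟨s, hs⟩ := eq_sum_coeffRight ((Equiv.sumComm β α).trans e) f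
    rw [hs s subset_rfl, map_sum]
    refine Finset.sum_congr rfl fun d _ => ?_
    rw [pair_comm, mapRight_pair]
    have := DFunLike.congr_fun hq ⟨_, hW d⟩
    simp only [LinearMap.comp_apply, Submodule.subtype_apply, LinearMap.id_apply] at this ⊢
    rw [this]
  obtain ⟨s, hs⟩ := eq_sum_coeffRight e f
  rw [hf, hs s subset_rfl, map_sum]
  refine Submodule.sum_mem _ fun c _ => ?_
  rw [mapRight_pair]
  exact Submodule.apply_mem_map₂ _ (hU c) (q _).2

/-- Multiplication by `q` has a `K`-linear left inverse `r`. Acting on the second variables only,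
`r` commutes with multiplication by `p`, so it carries the divisibility over to `f`. -/
theorem dvd_of_rename_dvd_rename_mul (e : α ⊕ β ≃ γ) {p : MvPolynomial α K}
    {q : MvPolynomial β K} (hq : q ≠ 0) {f : MvPolynomial γ K}
    (h : rename (e ∘ Sum.inl) p ∣ rename (e ∘ Sum.inr) q * f) : rename (e ∘ Sum.inl) p ∣ f := by
  obtain ⟨r, hr⟩ := (LinearMap.mulLeft K q).exists_leftInverse_of_injective
    (LinearMap.ker_eq_bot.2 (mul_right_injective₀ hq))
  obtain ⟨g, hg⟩ := h
  have h₁ : mapRight e r (rename (e ∘ Sum.inr) q * f) = f := by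
    clear hg
    induction f using pair_induction e with
    | hpair f' g' =>
      rw [← pair_one_left, pair_mul_pair, one_mul, mapRight_pair]
      exact congrArg _ (DFunLike.congr_fun hr g')
    | hadd f g hf hg => rw [mul_add, map_add, hf, hg]
  have h₂ : mapRight e r (rename (e ∘ Sum.inl) p * g) =
      rename (e ∘ Sum.inl) p * mapRight e r g := by
    clear hg
    induction g using pair_induction e with
    | hpair f' g' =>
      rw [← pair_one_right, pair_mul_pair, one_mul, mapRight_pair, mapRight_pair, pair_mul_pair,
        one_mul]
    | hadd f g hf hg => rw [mul_add, map_add, hf, hg, map_add, mul_add]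
  exact ⟨_, by rw [← h₁, hg, h₂]⟩

end Split

/-! ### Coefficients, products and weighted homogeneity -/

section Weights

variable {K α β γ : Type*} [Field K]

theorem mapDomain_add_mapDomain_injective (e : α ⊕ β ≃ γ) {d d' : α →₀ ℕ} {c c' : β →₀ ℕ}
    (h : d.mapDomain (e ∘ Sum.inl) + c.mapDomain (e ∘ Sum.inr) =
      d'.mapDomain (e ∘ Sum.inl) + c'.mapDomain (e ∘ Sum.inr)) : d = d' ∧ c = c' := by
  have hl := e.injective.comp (Sum.inl_injective (α := α) (β := β))
  have hr := e.injective.comp (Sum.inr_injective (α := α) (β := β))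
  have hlr : ∀ (a : α) (c : β →₀ ℕ), c.mapDomain (e ∘ Sum.inr) ((e ∘ Sum.inl) a) = 0 :=
    fun a c => Finsupp.mapDomain_of_notMem_range _ _ (by simp)
  have hrl : ∀ (b : β) (d : α →₀ ℕ), d.mapDomain (e ∘ Sum.inl) ((e ∘ Sum.inr) b) = 0 :=
    fun a c => Finsupp.mapDomain_of_notMem_range _ _ (by simp)
  constructor
  · ext a
    have := DFunLike.congr_fun h ((e ∘ Sum.inl) a)
    simpa only [Finsupp.add_apply, hlr, Finsupp.mapDomain_apply hl, add_zero] using this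
  · ext b
    have := DFunLike.congr_fun h ((e ∘ Sum.inr) b)
    simpa only [Finsupp.add_apply, hrl, Finsupp.mapDomain_apply hr, zero_add] using this

theorem pair_monomial (e : α ⊕ β ≃ γ) (d : α →₀ ℕ) (c : β →₀ ℕ) (a b : K) :
    pair e (monomial d a) (monomial c b) =
      monomial (d.mapDomain (e ∘ Sum.inl) + c.mapDomain (e ∘ Sum.inr)) (a * b) := by
  rw [pair_apply, rename_monomial, rename_monomial, monomial_mul]

theorem coeff_coeffRight (e : α ⊕ β ≃ γ) (d : α →₀ ℕ) (c : β →₀ ℕ) (f : MvPolynomial γ K) :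
    coeff d (coeffRight e c f) =
      coeff (d.mapDomain (e ∘ Sum.inl) + c.mapDomain (e ∘ Sum.inr)) f := by
  classical
  induction f using pair_induction e with
  | hadd f g hf hg => rw [map_add, coeff_add, coeff_add, hf, hg]
  | hpair f g =>
    rw [coeffRight_pair, coeff_smul]
    induction f using MvPolynomial.induction_on' with
    | add p q hp hq => rw [coeff_add, smul_add, hp, hq, map_add, LinearMap.add_apply, coeff_add]
    | monomial d' a =>
      induction g using MvPolynomial.induction_on' with
      | add p q hp hq => rw [coeff_add, add_smul, hp, hq, map_add, coeff_add]
      | monomial c' b =>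
        rw [pair_monomial, coeff_monomial, coeff_monomial, coeff_monomial]
        by_cases h : d' = d ∧ c' = c
        · obtain ⟨rfl, rfl⟩ := h
          simp [mul_comm]
        · rw [if_neg (c := _ = _ + _)]
          · by_cases hd : d' = d
            · have : c' ≠ c := fun hc => h ⟨hd, hc⟩
              simp [this]
            · simp [hd]
          · exact fun h' => h (mapDomain_add_mapDomain_injective e h')

theorem weight_mapDomain (W : β → ℕ) (g : α → β) (d : α →₀ ℕ) :
    Finsupp.weight W (d.mapDomain g) = Finsupp.weight (W ∘ g) d := by
  simp only [Finsupp.weight_apply]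
  rw [Finsupp.sum_mapDomain_index (by simp) (by intros; rw [add_smul])]
  rfl

theorem isWeightedHomogeneous_coeffRight (e : α ⊕ β ≃ γ) {W : γ → ℕ} {f : MvPolynomial γ K}
    {m i : ℕ} (hf : IsWeightedHomogeneous W f m) {c : β →₀ ℕ}
    (hi : i + Finsupp.weight (W ∘ e ∘ Sum.inr) c = m) :
    IsWeightedHomogeneous (W ∘ e ∘ Sum.inl) (coeffRight e c f) i := by
  intro d hd
  rw [coeff_coeffRight] at hd
  have := hf hd
  rw [map_add, weight_mapDomain, weight_mapDomain] at this
  omega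

theorem coeffRight_eq_zero (e : α ⊕ β ≃ γ) {W : γ → ℕ} {f : MvPolynomial γ K}
    {m : ℕ} (hf : IsWeightedHomogeneous W f m) {c : β →₀ ℕ}
    (hi : m < Finsupp.weight (W ∘ e ∘ Sum.inr) c) : coeffRight e c f = 0 := by
  ext d
  by_contra hd
  rw [coeff_zero, coeff_coeffRight] at hd
  have := hf hd
  rw [map_add, weight_mapDomain, weight_mapDomain] at this
  omega

theorem isWeightedHomogeneous_rename {W : β → ℕ} (g : α → β) {f : MvPolynomial α K} {m : ℕ}
    (hf : IsWeightedHomogeneous (W ∘ g) f m) : IsWeightedHomogeneous W (rename g f) m := by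
  intro d hd
  obtain ⟨u, rfl, hu⟩ := coeff_rename_ne_zero g f d hd
  rw [weight_mapDomain]
  exact hf hu

theorem isWeightedHomogeneous_pair (e : α ⊕ β ≃ γ) {W : γ → ℕ} {f : MvPolynomial α K}
    {g : MvPolynomial β K} {i j : ℕ} (hf : IsWeightedHomogeneous (W ∘ e ∘ Sum.inl) f i)
    (hg : IsWeightedHomogeneous (W ∘ e ∘ Sum.inr) g j) :
    IsWeightedHomogeneous W (pair e f g) (i + j) := by
  rw [pair_apply]
  exact (isWeightedHomogeneous_rename _ hf).mul (isWeightedHomogeneous_rename _ hg)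

end Weights

/-! ### Faithfulness and gradings of symbols -/

section Symbols

variable {K σ : Type*} [Field K]

/-- With `Equiv.refl` as partition, the second variables are those standing for the derivatives. -/
theorem coeffRight_zero_eq_symOp_one (F : MvPolynomial (σ ⊕ σ) K) :
    coeffRight (Equiv.refl _) 0 F = symOp F 1 := by
  induction F using pair_induction (Equiv.refl (σ ⊕ σ)) with
  | hpair f g =>
    rw [coeffRight_pair, pair_apply, symOp_one_eq, map_mul, aeval_rename, aeval_rename]
    have h₁ : (Sum.elim X 0 ∘ (Equiv.refl (σ ⊕ σ)) ∘ Sum.inl : σ → MvPolynomial σ K) = X := rfl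
    have h₂ : (Sum.elim X 0 ∘ (Equiv.refl (σ ⊕ σ)) ∘ Sum.inr : σ → MvPolynomial σ K) = 0 := rfl
    rw [h₁, h₂, aeval_X_left, aeval_zero, ← C_mul', mul_comm]
    rfl
  | hadd f g hf hg => simp only [map_add, LinearMap.add_apply, hf, hg]

theorem coeff_symOp_one (F : MvPolynomial (σ ⊕ σ) K) (c : σ →₀ ℕ) :
    coeff c (symOp F 1) = coeff (c.mapDomain Sum.inl) F := by
  rw [← coeffRight_zero_eq_symOp_one, coeff_coeffRight, Finsupp.mapDomain_zero, add_zero]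
  rfl

/-- The coefficient of `∂^0` is the value of the operator at `1`. Commuting with `x_i` lowers the
exponent of `∂_i` at the cost of a nonzero integer factor, so induction on `c.degree` shows that
every coefficient vanishes. -/
theorem symOp_injective [CharZero K] :
    Function.Injective (symOp : MvPolynomial (σ ⊕ σ) K → _) := by
  rw [injective_iff_map_eq_zero]
  have key : ∀ (n : ℕ) (c : σ →₀ ℕ) (F : MvPolynomial (σ ⊕ σ) K), c.degree = n → symOp F = 0 →
      coeffRight (Equiv.refl _) c F = 0 := by
    intro n
    induction n with
    | zero =>
      intro c F hc hF
      rw [(Finsupp.degree_eq_zero_iff c).1 hc, coeffRight_zero_eq_symOp_one, hF]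
      rfl
    | succ n ih =>
      intro c F hc hF
      obtain ⟨i, hi⟩ : ∃ i, c i ≠ 0 := by
        by_contra! h
        have : c = 0 := Finsupp.ext h
        simp [this] at hc
      have hle : Finsupp.single i 1 ≤ c := Finsupp.single_le_iff.2 (Nat.one_le_iff_ne_zero.2 hi)
      obtain ⟨c', rfl⟩ : ∃ c', c = c' + Finsupp.single i 1 := ⟨_, (tsub_add_cancel_of_le hle).symm⟩
      have hp : symOp (pderiv (Sum.inr i) F) = 0 := by
        refine LinearMap.ext fun f => ?_
        have := symOp_X_mul F i f
        simpa [hF] using this.symm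
      have := ih c' _ (by simpa using hc) hp
      have h' := coeffRight_pderiv (Equiv.refl (σ ⊕ σ)) c' i F
      simp only [Equiv.refl_apply] at h'
      rw [this] at h'
      exact (smul_eq_zero.1 h'.symm).resolve_left (Nat.cast_add_one_ne_zero _)
  exact fun F hF => eq_zero_of_coeffRight (Equiv.refl _) fun c => key _ c F rfl hF

/-- The weight counting the order of a differential operator. -/
def orderWeight (σ : Type*) : σ ⊕ σ → ℕ := Sum.elim 0 1

/-- The weight counting the polynomial degree of the coefficients of a differential operator. -/
def degreeWeight (σ : Type*) : σ ⊕ σ → ℕ := Sum.elim 1 0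

theorem weight_orderWeight (w : σ ⊕ σ →₀ ℕ) :
    Finsupp.weight (orderWeight σ) w = (Finsupp.sumFinsuppAddEquivProdFinsupp w).2.degree := by
  induction w using Finsupp.induction_linear with
  | zero => simp
  | add f g hf hg => simp only [map_add, hf, hg, Prod.snd_add]
  | single i n =>
    have h : ∀ i : σ ⊕ σ, Finsupp.weight (orderWeight σ) (Finsupp.single i 1) =
        (Finsupp.sumFinsuppAddEquivProdFinsupp (Finsupp.single i 1 : σ ⊕ σ →₀ ℕ)).2.degree := by
      rintro (i | i)
      · rw [sumFinsupp_single_inl]; simp [orderWeight, Finsupp.weight_single]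
      · rw [sumFinsupp_single_inr]; simp [orderWeight, Finsupp.weight_single]
    induction n with
    | zero => simp
    | succ n ih => simp only [Finsupp.single_add, map_add, ih, Prod.snd_add, h]

theorem weight_degreeWeight (w : σ ⊕ σ →₀ ℕ) :
    Finsupp.weight (degreeWeight σ) w = (Finsupp.sumFinsuppAddEquivProdFinsupp w).1.degree := by
  induction w using Finsupp.induction_linear with
  | zero => simp
  | add f g hf hg => simp only [map_add, hf, hg, Prod.fst_add]
  | single i n =>
    have h : ∀ i : σ ⊕ σ, Finsupp.weight (degreeWeight σ) (Finsupp.single i 1) =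
        (Finsupp.sumFinsuppAddEquivProdFinsupp (Finsupp.single i 1 : σ ⊕ σ →₀ ℕ)).1.degree := by
      rintro (i | i)
      · rw [sumFinsupp_single_inl]; simp [degreeWeight, Finsupp.weight_single]
      · rw [sumFinsupp_single_inr]; simp [degreeWeight, Finsupp.weight_single]
    induction n with
    | zero => simp
    | succ n ih => simp only [Finsupp.single_add, map_add, ih, Prod.fst_add, h]

theorem mem_diffOps_iff {m : ℕ} {θ : Module.End K (MvPolynomial σ K)} :
    θ ∈ diffOps K σ m ↔ ∃ F, IsWeightedHomogeneous (orderWeight σ) F m ∧ symOp F = θ := by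
  constructor
  · intro h
    induction h using Submodule.span_induction with
    | mem θ h =>
      obtain ⟨a, ha, rfl⟩ := h
      refine ⟨_, isWeightedHomogeneous_rename _ ?_, symOp_rename_inr_monomial a⟩
      refine isWeightedHomogeneous_monomial _ _ _ ?_
      rw [← ha, Finsupp.degree_eq_weight_one]
      rfl
    | zero => exact ⟨0, isWeightedHomogeneous_zero _ _ _, map_zero _⟩
    | add θ η _ _ h₁ h₂ =>
      obtain ⟨F, hF, rfl⟩ := h₁
      obtain ⟨G, hG, rfl⟩ := h₂
      exact ⟨F + G, hF.add hG, map_add _ _ _⟩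
    | smul f θ _ h =>
      obtain ⟨F, hF, rfl⟩ := h
      refine ⟨rename Sum.inl f * F, ?_, symOp_rename_inl_mul f F⟩
      have h0 : IsWeightedHomogeneous (orderWeight σ) (rename Sum.inl f) 0 := by
        refine isWeightedHomogeneous_rename _ fun d _ => ?_
        simp [Finsupp.weight_apply, orderWeight]
      simpa using h0.mul hF
  · rintro ⟨F, hF, rfl⟩
    rw [F.as_sum, map_sum]
    refine Submodule.sum_mem _ fun w hw => ?_
    rw [symOp_monomial]
    refine Submodule.smul_mem _ _ (Submodule.subset_span ⟨_, ?_, rfl⟩)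
    rw [← weight_orderWeight]
    exact hF (mem_support_iff.1 hw)

theorem isHomogeneous_symOp {F : MvPolynomial (σ ⊕ σ) K} {m d n : ℕ} {f : MvPolynomial σ K}
    (hF : IsWeightedHomogeneous (orderWeight σ) F m)
    (hF' : IsWeightedHomogeneous (degreeWeight σ) F d) (hf : f.IsHomogeneous n) :
    (symOp F f).IsHomogeneous (d + (n - m)) := by
  rw [F.as_sum, map_sum, LinearMap.sum_apply]
  refine IsHomogeneous.sum _ _ _ fun w hw => ?_
  have hw := mem_support_iff.1 hw
  rw [symOp_monomial, LinearMap.smul_apply, smul_eq_mul, ← hF hw, ← hF' hw, weight_orderWeight,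
    weight_degreeWeight]
  exact (isHomogeneous_monomial _ rfl).mul (isHomogeneous_partialPow hf _)

end Symbols

/-! ### Differential operators by iterated commutators -/

section Order

variable {K σ : Type*} [Field K]

/-- Grothendieck's differential operators of order less than `n`. -/
def IsDiffOp : ℕ → Module.End K (MvPolynomial σ K) → Prop
  | 0, θ => θ = 0
  | n + 1, θ => ∀ f, IsDiffOp n (θ * LinearMap.mulLeft K f - LinearMap.mulLeft K f * θ)

namespace IsDiffOp

variable {n : ℕ} {θ η : Module.End K (MvPolynomial σ K)}

theorem add (hθ : IsDiffOp n θ) (hη : IsDiffOp n η) : IsDiffOp n (θ + η) := by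
  induction n generalizing θ η with
  | zero => rw [IsDiffOp] at *; rw [hθ, hη, add_zero]
  | succ n ih =>
    intro f
    have := ih (hθ f) (hη f)
    convert! this using 1
    simp only [mul_add, add_mul]
    abel

theorem zero (n : ℕ) : IsDiffOp n (0 : Module.End K (MvPolynomial σ K)) := by
  induction n with
  | zero => rfl
  | succ n ih => intro f; simpa using ih

theorem succ (hθ : IsDiffOp n θ) : IsDiffOp (n + 1) θ := by
  induction n generalizing θ with
  | zero => rw [IsDiffOp] at hθ; rw [hθ]; exact zero _
  | succ n ih => exact fun f => ih (hθ f)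

theorem mono {m : ℕ} (hθ : IsDiffOp n θ) (h : n ≤ m) : IsDiffOp m θ := by
  induction h with
  | refl => exact hθ
  | step _ ih => exact ih.succ

theorem mulLeft_mul (hθ : IsDiffOp n θ) (g : MvPolynomial σ K) :
    IsDiffOp n (LinearMap.mulLeft K g * θ) := by
  induction n generalizing θ with
  | zero => rw [IsDiffOp] at *; rw [hθ, mul_zero]
  | succ n ih =>
    intro f
    convert! ih (hθ f) using 1
    have : LinearMap.mulLeft K f * LinearMap.mulLeft K g =
        LinearMap.mulLeft K g * LinearMap.mulLeft K f := by
      refine LinearMap.ext fun p => ?_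
      simp only [Module.End.mul_apply, LinearMap.mulLeft_apply]
      ring
    rw [← mul_assoc (LinearMap.mulLeft K f), this]
    simp only [mul_sub, mul_assoc]

theorem mul_mulLeft (hθ : IsDiffOp n θ) (g : MvPolynomial σ K) :
    IsDiffOp n (θ * LinearMap.mulLeft K g) := by
  induction n generalizing θ with
  | zero => rw [IsDiffOp] at *; rw [hθ, zero_mul]
  | succ n ih =>
    intro f
    convert! ih (hθ f) using 1
    have : LinearMap.mulLeft K g * LinearMap.mulLeft K f =
        LinearMap.mulLeft K f * LinearMap.mulLeft K g := by
      refine LinearMap.ext fun p => ?_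
      simp only [Module.End.mul_apply, LinearMap.mulLeft_apply]
      ring
    rw [mul_assoc θ, this]
    simp only [sub_mul, mul_assoc]

theorem mul_partialOp (hθ : IsDiffOp n θ) (i : σ) : IsDiffOp (n + 1) (θ * partialOp K i) := by
  induction n generalizing θ with
  | zero => rw [IsDiffOp] at hθ; rw [hθ, zero_mul]; exact zero _
  | succ n ih =>
    intro f
    have h : partialOp K i * LinearMap.mulLeft K f =
        LinearMap.mulLeft K f * partialOp K i + LinearMap.mulLeft K (partialOp K i f) := by
      refine LinearMap.ext fun p => ?_
      simp only [Module.End.mul_apply, LinearMap.mulLeft_apply, LinearMap.add_apply, partialOp,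
        Derivation.coeFn_coe, Derivation.leibniz, smul_eq_mul]
      ring
    convert! (ih (hθ f)).add (hθ.mul_mulLeft (partialOp K i f)) using 1
    rw [mul_assoc θ, h]
    simp only [sub_mul, mul_add, mul_assoc]
    abel

/-- Constants have order zero, left multiplication by `x_i` keeps the bound and composition with
`∂_i` raises it by one. -/
theorem exists_symOp (F : MvPolynomial (σ ⊕ σ) K) : ∃ n, IsDiffOp n (symOp F) := by
  induction F using MvPolynomial.induction_on with
  | C c =>
    refine ⟨1, fun f => ?_⟩
    rw [symOp_C, IsDiffOp]
    refine LinearMap.ext fun g => ?_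
    simp
  | add p q hp hq =>
    obtain ⟨n, hn⟩ := hp
    obtain ⟨k, hk⟩ := hq
    refine ⟨max n k, ?_⟩
    rw [map_add]
    exact (hn.mono (le_max_left _ _)).add (hk.mono (le_max_right _ _))
  | mul_X p i hp =>
    obtain ⟨n, hn⟩ := hp
    rcases i with i | i
    · refine ⟨n, ?_⟩
      rw [symOp_mul_X_inl]
      exact hn.mulLeft_mul (X i)
    · exact ⟨n + 1, by rw [symOp_mul_X_inr]; exact hn.mul_partialOp i⟩

/-- If a differential operator maps `(f h)` to `(h)`, with `f` a nonzerodivisor modulo `h`, then it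
maps `(h)` to `(h)`. -/
theorem dvd_of_dvd_mul (hθ : IsDiffOp n θ) {f h : MvPolynomial σ K}
    (hfh : ∀ g, h ∣ f * g → h ∣ g) (H : ∀ g, h ∣ θ (f * (h * g))) (g : MvPolynomial σ K) :
    h ∣ θ (h * g) := by
  induction n generalizing θ g with
  | zero => rw [IsDiffOp] at hθ; simp [hθ]
  | succ n ih =>
    -- The commutator of `θ` with `f` has smaller order and inherits the hypothesis `H`. It
    -- therefore preserves `(h)`, so `h` divides `f * θ (h * g)`, and `f` can be cancelled.
    have h₁ : h ∣ θ (f * (h * g)) - f * θ (h * g) := by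
      refine ih (hθ f) (fun g => ?_) g
      simp only [LinearMap.sub_apply, Module.End.mul_apply, LinearMap.mulLeft_apply]
      refine dvd_sub ?_ (Dvd.dvd.mul_left (H g) f)
      have := H (f * g)
      rwa [mul_left_comm h f g] at this
    exact hfh _ ((dvd_sub_right (H g)).1 h₁)

end IsDiffOp

end Order

/-! ### Operators preserving a principal ideal, and their decomposition for products -/

section Preserves

variable {K σ ι₁ ι₂ : Type*} [Field K]

/-- `θ` maps the ideal `(Q)` to itself. -/
def Preserves (Q : MvPolynomial σ K) (θ : Module.End K (MvPolynomial σ K)) : Prop :=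
  ∀ g, Q ∣ θ (Q * g)

theorem Preserves.add {Q : MvPolynomial σ K} {θ η : Module.End K (MvPolynomial σ K)}
    (hθ : Preserves Q θ) (hη : Preserves Q η) : Preserves Q (θ + η) :=
  fun g => dvd_add (hθ g) (hη g)

/-- The symbols of the operators of order `m` that preserve `(Q)`. -/
def symPres (Q : MvPolynomial σ K) (m : ℕ) : Submodule K (MvPolynomial (σ ⊕ σ) K) where
  carrier := {F | IsWeightedHomogeneous (orderWeight σ) F m ∧ Preserves Q (symOp F)}
  zero_mem' := ⟨isWeightedHomogeneous_zero _ _ _, fun g => by simp⟩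
  add_mem' hF hG := ⟨hF.1.add hG.1, by rw [map_add]; exact hF.2.add hG.2⟩
  smul_mem' c F hF := ⟨(weightedHomogeneousSubmodule K _ _).smul_mem c hF.1, fun g => by
    rw [map_smul, LinearMap.smul_apply, ← C_mul']; exact (hF.2 g).mul_left _⟩

/-- The partition of the variables of symbols induced by a partition of the variables. -/
def symSplit (e : ι₁ ⊕ ι₂ ≃ σ) : (ι₁ ⊕ ι₁) ⊕ (ι₂ ⊕ ι₂) ≃ σ ⊕ σ :=
  (Equiv.sumSumSumComm ι₁ ι₁ ι₂ ι₂).trans (Equiv.sumCongr e e)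

theorem symSplit_swap (e : ι₁ ⊕ ι₂ ≃ σ) :
    symSplit ((Equiv.sumComm ι₂ ι₁).trans e) = (Equiv.sumComm _ _).trans (symSplit e) := by
  ext ((i | i) | (i | i)) <;> rfl

theorem orderWeight_comp_inl (e : ι₁ ⊕ ι₂ ≃ σ) :
    orderWeight σ ∘ symSplit e ∘ Sum.inl = orderWeight ι₁ := by
  ext (i | i) <;> rfl

theorem orderWeight_comp_inr (e : ι₁ ⊕ ι₂ ≃ σ) :
    orderWeight σ ∘ symSplit e ∘ Sum.inr = orderWeight ι₂ := by
  ext (i | i) <;> rfl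

theorem symOp_pair_pair (e : ι₁ ⊕ ι₂ ≃ σ) (F : MvPolynomial (ι₁ ⊕ ι₁) K)
    (G : MvPolynomial (ι₂ ⊕ ι₂) K) (p : MvPolynomial ι₁ K) (q : MvPolynomial ι₂ K) :
    symOp (pair (symSplit e) F G) (pair e p q) = pair e (symOp F p) (symOp G q) := by
  induction F using MvPolynomial.induction_on generalizing p with
  | add F F' h h' => simp only [map_add, LinearMap.add_apply, h, h']
  | C c =>
    induction G using MvPolynomial.induction_on generalizing q with
    | add F F' h h' => simp only [map_add, LinearMap.add_apply, h, h']
    | C d =>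
      rw [pair_apply, rename_C, rename_C, ← C_mul, symOp_C, symOp_C, symOp_C]
      simp [smul_smul, mul_comm]
    | mul_X G i h =>
      have hX : pair (symSplit e) (C c) (G * X i) =
          pair (symSplit e) (C c) G * X (symSplit e (Sum.inr i)) := by
        rw [pair_apply, pair_apply, map_mul, rename_X, mul_assoc]; rfl
      rw [hX]
      rcases i with i | i
      · have : symSplit e (Sum.inr (Sum.inl i)) = Sum.inl (e (Sum.inr i)) := rfl
        rw [this, symOp_mul_X_inl, symOp_mul_X_inl, LinearMap.smul_apply, h, LinearMap.smul_apply,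
          smul_eq_mul, smul_eq_mul, pair_apply, pair_apply, map_mul, rename_X, mul_left_comm]
        rfl
      · have : symSplit e (Sum.inr (Sum.inr i)) = Sum.inr (e (Sum.inr i)) := rfl
        rw [this, symOp_mul_X_inr, symOp_mul_X_inr, Module.End.mul_apply, Module.End.mul_apply, ← h]
        exact congrArg _ (pderiv_pair_right e i p q)
  | mul_X F i h =>
    have hX : pair (symSplit e) (F * X i) G =
        pair (symSplit e) F G * X (symSplit e (Sum.inl i)) := by
      rw [pair_apply, pair_apply, map_mul, rename_X, mul_right_comm]; rfl
    rw [hX]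
    rcases i with i | i
    · have : symSplit e (Sum.inl (Sum.inl i)) = Sum.inl (e (Sum.inl i)) := rfl
      rw [this, symOp_mul_X_inl, symOp_mul_X_inl, LinearMap.smul_apply, h, LinearMap.smul_apply,
        smul_eq_mul, smul_eq_mul, pair_apply, pair_apply, map_mul, rename_X, mul_assoc]
      rfl
    · have : symSplit e (Sum.inl (Sum.inr i)) = Sum.inr (e (Sum.inl i)) := rfl
      rw [this, symOp_mul_X_inr, symOp_mul_X_inr, Module.End.mul_apply, Module.End.mul_apply, ← h]
      exact congrArg _ (pderiv_pair_left e i p q)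

/-- On polynomials in the first variables, derivatives in the second ones vanish. Hence only
exponents of the form `x^c ∂^0` in the second group contribute. -/
theorem coeffRight_symOp_rename (e : ι₁ ⊕ ι₂ ≃ σ) (F : MvPolynomial (σ ⊕ σ) K)
    (p : MvPolynomial ι₁ K) (c : ι₂ →₀ ℕ) :
    coeffRight e c (symOp F (rename (e ∘ Sum.inl) p)) =
      symOp (coeffRight (symSplit e) (c.mapDomain Sum.inl) F) p := by
  induction F using pair_induction (symSplit e) with
  | hadd f g hf hg => simp only [map_add, LinearMap.add_apply, hf, hg]
  | hpair F G =>
    rw [← pair_one_right, symOp_pair_pair, coeffRight_pair, coeff_symOp_one, coeffRight_pair,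
      map_smul, LinearMap.smul_apply]

/-- The derived symbol belongs to the commutator with `x_i`, and multiplication by `x_i` preserves
every ideal. -/
theorem Preserves.pderiv {Q : MvPolynomial σ K} {F : MvPolynomial (σ ⊕ σ) K}
    (hF : Preserves Q (symOp F)) (i : σ) : Preserves Q (symOp (pderiv (Sum.inr i) F)) := by
  intro g
  have h₁ := hF (X i * g)
  rw [mul_left_comm, symOp_X_mul] at h₁
  exact (dvd_add_right ((hF g).mul_left _)).1 h₁

/-- Induction on the `∂`-degree of `c`. If it is zero, the coefficient can be read off from the
action on polynomials in the first variables. Otherwise `c` is lowered by passing to the derived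
symbol, which still preserves the ideal, and the integer factor is inverted. -/
theorem Preserves.coeffRight [CharZero K] (e : ι₁ ⊕ ι₂ ≃ σ) {Q : MvPolynomial ι₁ K}
    {F : MvPolynomial (σ ⊕ σ) K} (hF : Preserves (rename (e ∘ Sum.inl) Q) (symOp F))
    (c : ι₂ ⊕ ι₂ →₀ ℕ) : Preserves Q (symOp (coeffRight (symSplit e) c F)) := by
  obtain ⟨n, hn⟩ : ∃ n, (Finsupp.sumFinsuppAddEquivProdFinsupp c).2.degree = n := ⟨_, rfl⟩
  induction n generalizing F c with
  | zero =>
    intro g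
    obtain ⟨d, rfl⟩ : ∃ d : ι₂ →₀ ℕ, c = d.mapDomain Sum.inl := by
      refine ⟨(Finsupp.sumFinsuppAddEquivProdFinsupp c).1, ?_⟩
      rw [Finsupp.degree_eq_zero_iff] at hn
      ext (i | i)
      · rw [Finsupp.mapDomain_apply Sum.inl_injective]; simp
      · rw [Finsupp.mapDomain_of_notMem_range _ _ (by simp)]
        simpa using DFunLike.congr_fun hn i
    rw [← coeffRight_symOp_rename, map_mul]
    obtain ⟨h, hh⟩ := hF (rename (e ∘ Sum.inl) g)
    rw [hh, coeffRight_rename_mul]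
    exact dvd_mul_right _ _
  | succ n ih =>
    obtain ⟨i, hi⟩ : ∃ i, c (Sum.inr i) ≠ 0 := by
      by_contra! h
      have : (Finsupp.sumFinsuppAddEquivProdFinsupp c).2 = 0 := by
        ext i; simpa using h i
      rw [this, map_zero] at hn
      omega
    have hle : Finsupp.single (Sum.inr i) 1 ≤ c :=
      Finsupp.single_le_iff.2 (Nat.one_le_iff_ne_zero.2 hi)
    obtain ⟨c', rfl⟩ : ∃ c', c = c' + Finsupp.single (Sum.inr i) 1 :=
      ⟨_, (tsub_add_cancel_of_le hle).symm⟩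
    have h₁ := ih (hF.pderiv (e (Sum.inr i))) c' (by
      rw [map_add, sumFinsupp_single_inr, Prod.snd_add, map_add, Finsupp.degree_single] at hn
      omega)
    have h₂ := coeffRight_pderiv (symSplit e) c' (Sum.inr i) F
    rw [show symSplit e (Sum.inr (Sum.inr i)) = Sum.inr (e (Sum.inr i)) from rfl] at h₂
    rw [h₂] at h₁
    intro g
    have h₃ := (h₁ g).mul_left (C ((c' (Sum.inr i) : K) + 1)⁻¹)
    rwa [map_smul, LinearMap.smul_apply, C_mul', smul_smul,
      inv_mul_cancel₀ (Nat.cast_add_one_ne_zero _), one_smul] at h₃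

/-- Here `Q₂` plays the role of the nonzerodivisor modulo `Q₁` in `IsDiffOp.dvd_of_dvd_mul`. -/
theorem Preserves.of_pair (e : ι₁ ⊕ ι₂ ≃ σ) {Q₁ : MvPolynomial ι₁ K} {Q₂ : MvPolynomial ι₂ K}
    (hQ₂ : Q₂ ≠ 0) {F : MvPolynomial (σ ⊕ σ) K} (hF : Preserves (pair e Q₁ Q₂) (symOp F)) :
    Preserves (rename (e ∘ Sum.inl) Q₁) (symOp F) := by
  obtain ⟨n, hn⟩ := IsDiffOp.exists_symOp F
  refine fun g => hn.dvd_of_dvd_mul (f := rename (e ∘ Sum.inr) Q₂)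
    (fun g hg => dvd_of_rename_dvd_rename_mul e hQ₂ hg) (fun g => ?_) g
  have := hF g
  rw [pair_apply] at this
  rw [← mul_assoc, mul_comm (rename (e ∘ Sum.inr) Q₂)]
  exact (dvd_mul_right _ _).trans this

theorem coeffRight_mem_symPres [CharZero K] (e : ι₁ ⊕ ι₂ ≃ σ) {Q₁ : MvPolynomial ι₁ K}
    {Q₂ : MvPolynomial ι₂ K} (hQ₂ : Q₂ ≠ 0) {m i : ℕ} {F : MvPolynomial (σ ⊕ σ) K}
    (hF : F ∈ symPres (pair e Q₁ Q₂) m) {c : ι₂ ⊕ ι₂ →₀ ℕ}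
    (hc : i + Finsupp.weight (orderWeight ι₂) c = m) :
    coeffRight (symSplit e) c F ∈ symPres Q₁ i := by
  refine ⟨?_, Preserves.coeffRight e (Preserves.of_pair e hQ₂ hF.2) c⟩
  rw [← orderWeight_comp_inl e]
  rw [← orderWeight_comp_inr e] at hc
  exact isWeightedHomogeneous_coeffRight _ hF.1 hc

theorem coeffRight_mem_iSup_symPres [CharZero K] (e : ι₁ ⊕ ι₂ ≃ σ) {Q₁ : MvPolynomial ι₁ K}
    {Q₂ : MvPolynomial ι₂ K} (hQ₂ : Q₂ ≠ 0) {m : ℕ} {F : MvPolynomial (σ ⊕ σ) K}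
    (hF : F ∈ symPres (pair e Q₁ Q₂) m) (c : ι₂ ⊕ ι₂ →₀ ℕ) :
    coeffRight (symSplit e) c F ∈ ⨆ i, symPres Q₁ i := by
  by_cases hc : Finsupp.weight (orderWeight ι₂) c ≤ m
  · exact Submodule.mem_iSup_of_mem (m - Finsupp.weight (orderWeight ι₂) c)
      (coeffRight_mem_symPres e hQ₂ hF (by omega))
  · rw [← orderWeight_comp_inr e] at hc
    rw [coeffRight_eq_zero _ hF.1 (not_le.1 hc)]
    exact Submodule.zero_mem _

theorem pair_mem_symPres (e : ι₁ ⊕ ι₂ ≃ σ) {Q₁ : MvPolynomial ι₁ K} {Q₂ : MvPolynomial ι₂ K}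
    {i j : ℕ} {F : MvPolynomial (ι₁ ⊕ ι₁) K} {G : MvPolynomial (ι₂ ⊕ ι₂) K}
    (hF : F ∈ symPres Q₁ i) (hG : G ∈ symPres Q₂ j) :
    pair (symSplit e) F G ∈ symPres (pair e Q₁ Q₂) (i + j) := by
  refine ⟨isWeightedHomogeneous_pair _ ?_ ?_, fun g => ?_⟩
  · rw [orderWeight_comp_inl]; exact hF.1
  · rw [orderWeight_comp_inr]; exact hG.1
  · induction g using pair_induction e with
    | hadd f g hf hg => rw [mul_add, map_add]; exact dvd_add hf hg
    | hpair p q =>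
      rw [pair_mul_pair, symOp_pair_pair]
      obtain ⟨p', hp⟩ := hF.2 p
      obtain ⟨q', hq⟩ := hG.2 q
      exact ⟨pair e p' q', by rw [pair_mul_pair, hp, hq]⟩

/-- Both families of slices of a symbol preserving the product ideal preserve the ideal of the
corresponding factor, so `mem_map₂_pair` places the symbol in a tensor product. The order then
selects the summands. -/
theorem symPres_pair [CharZero K] (e : ι₁ ⊕ ι₂ ≃ σ) {Q₁ : MvPolynomial ι₁ K}
    {Q₂ : MvPolynomial ι₂ K} (hQ₁ : Q₁ ≠ 0) (hQ₂ : Q₂ ≠ 0) (m : ℕ) :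
    symPres (pair e Q₁ Q₂) m = ⨆ i : Fin (m + 1),
      Submodule.map₂ (pair (symSplit e)) (symPres Q₁ i) (symPres Q₂ (m - i)) := by
  classical
  apply le_antisymm
  · intro F hF
    have h₁ : F ∈ Submodule.map₂ (pair (symSplit e)) (⨆ i, symPres Q₁ i) (⨆ j, symPres Q₂ j) := by
      refine mem_map₂_pair _ _ _ (coeffRight_mem_iSup_symPres e hQ₂ hF) fun d => ?_
      rw [← symSplit_swap]
      refine coeffRight_mem_iSup_symPres ((Equiv.sumComm ι₂ ι₁).trans e) (Q₂ := Q₁) hQ₁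
        (m := m) ?_ d
      rwa [pair_comm]
    rw [Submodule.map₂_iSup_left] at h₁
    simp only [Submodule.map₂_iSup_right] at h₁
    -- Projection to the component of order `m` fixes `F` and kills every product with `i + j ≠ m`.
    have h₂ : (⨆ i, ⨆ j, Submodule.map₂ (pair (symSplit e)) (symPres Q₁ i) (symPres Q₂ j)) ≤
        (⨆ i : Fin (m + 1), Submodule.map₂ (pair (symSplit e)) (symPres Q₁ i)
          (symPres Q₂ (m - i))).comap (weightedHomogeneousComponent (orderWeight σ) m) := by
      refine iSup_le fun i => iSup_le fun j => Submodule.map₂_le.2 fun u hu w hw => ?_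
      have hp := (pair_mem_symPres e hu hw).1
      rw [Submodule.mem_comap]
      by_cases hij : i + j = m
      · subst hij
        rw [hp.weightedHomogeneousComponent_same]
        refine Submodule.mem_iSup_of_mem (⟨i, by omega⟩ : Fin (i + j + 1)) ?_
        refine Submodule.apply_mem_map₂ _ hu ?_
        simpa using hw
      · rw [hp.weightedHomogeneousComponent_ne m (Ne.symm hij)]
        exact Submodule.zero_mem _
    have := h₂ h₁
    rwa [Submodule.mem_comap, hF.1.weightedHomogeneousComponent_same] at this
  · refine iSup_le fun i => Submodule.map₂_le.2 fun u hu w hw => ?_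
    have := pair_mem_symPres e hu hw
    rwa [show (i : ℕ) + (m - i) = m by omega] at this

end Preserves

/-! ### Graded projective modules over polynomial rings -/

section GradedProjective

variable {K σ : Type*} [Field K]

theorem mem_span_X_iff (f : MvPolynomial σ K) :
    f ∈ Ideal.span (Set.range (X : σ → MvPolynomial σ K)) ↔ constantCoeff f = 0 := by
  rw [← Set.image_univ, mem_ideal_span_X_image, constantCoeff_eq, ← notMem_support_iff]
  constructor
  · intro h h0
    obtain ⟨i, -, hi⟩ := h 0 h0
    exact hi rfl
  · intro h w hw
    by_contra! h'
    have : w = 0 := Finsupp.ext fun i => h' i (Set.mem_univ _)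
    exact h (this ▸ hw)

/-- A nonnegatively graded projective module over a polynomial ring is free. -/
theorem free_of_projective_of_graded [Finite σ] {M : Type*} [AddCommGroup M] [Module K M]
    [Module (MvPolynomial σ K) M] [IsScalarTower K (MvPolynomial σ K) M]
    [Module.Projective (MvPolynomial σ K) M] (comp : ℕ → M →ₗ[K] M)
    (hsum : ∀ w, w ∈ Submodule.span K (⋃ d, Set.range (comp d)))
    (hsame : ∀ d w, comp d (comp d w) = comp d w)
    (hne : ∀ d d' w, d ≠ d' → comp d (comp d' w) = 0)
    (hzero : ∀ i w, comp 0 ((X i : MvPolynomial σ K) • w) = 0)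
    (hsucc : ∀ d i w, comp (d + 1) ((X i : MvPolynomial σ K) • w) =
      (X i : MvPolynomial σ K) • comp d w) :
    Module.Free (MvPolynomial σ K) M := by
  classical
  let S := MvPolynomial σ K
  let I : Ideal S := Ideal.span (Set.range (X : σ → S))
  let N : Submodule S M := I • ⊤
  have hmk : ∀ (f : S) (w : M), N.mkQ (f • w) = constantCoeff f • N.mkQ w := by
    intro f w
    have h₁ : (f - C (constantCoeff f)) • w ∈ N :=
      Submodule.smul_mem_smul ((mem_span_X_iff _).2 (by simp)) Submodule.mem_top
    have h₂ := (Submodule.Quotient.mk_eq_zero N).2 h₁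
    rw [sub_smul, Submodule.Quotient.mk_sub, sub_eq_zero] at h₂
    have h₃ : (C (constantCoeff f) : S) • w = constantCoeff f • w := by
      rw [← algebraMap_eq, algebraMap_smul]
    rw [h₃] at h₂
    exact h₂
  let q : M →ₗ[K] M ⧸ N := N.mkQ.restrictScalars K
  let H : Set M := ⋃ d, Set.range (comp d)
  -- A `K`-basis of `M / IM` made of images of homogeneous elements; their lifts `v` are the
  -- candidates for a basis of `M`.
  obtain ⟨b, hbH, hbspan, hbli⟩ := exists_linearIndependent K (q '' H)
  have hb : ∀ y : b, ∃ w, w ∈ H ∧ q w = y := fun y => hbH y.2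
  choose v hvH hv using hb
  let π : (b →₀ S) →ₗ[S] M := Finsupp.linearCombination S v
  have hvπ : ∀ y, v y ∈ LinearMap.range π := fun y => ⟨Finsupp.single y 1, by simp [π]⟩
  -- Graded Nakayama: modulo the span of the lifts, a component of degree `d` comes from `IM`, hence
  -- from components of smaller degree.
  have hsurj : ∀ d w, comp d w ∈ LinearMap.range π := by
    intro d
    induction d using Nat.strong_induction_on with
    | _ d ih =>
      intro w
      have h₁ : q (comp d w) ∈ Submodule.map q (Submodule.span K (Set.range v)) := by
        rw [Submodule.map_span, ← Set.range_comp]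
        have : Set.range (q ∘ v) = b := by
          ext y
          constructor
          · rintro ⟨y, rfl⟩
            simp only [Function.comp_apply, hv]
            exact y.2
          · intro hy
            exact ⟨⟨y, hy⟩, hv _⟩
        rw [this, hbspan]
        exact Submodule.subset_span ⟨_, Set.mem_iUnion.2 ⟨d, w, rfl⟩, rfl⟩
      obtain ⟨p, hp, hpq⟩ := h₁
      have h₂ : comp d w - p ∈ N := (Submodule.Quotient.eq N).1 hpq.symm
      have h₃ : ∀ p ∈ Submodule.span K (Set.range v), comp d p ∈ LinearMap.range π := by
        intro p hp
        induction hp using Submodule.span_induction with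
        | mem x h =>
          obtain ⟨y, rfl⟩ := h
          obtain ⟨d', w', hd'⟩ := Set.mem_iUnion.1 (hvH y)
          by_cases h : d = d'
          · subst h
            rw [← hd', hsame, hd']
            exact hvπ y
          · rw [← hd', hne _ _ _ h]
            exact Submodule.zero_mem _
        | zero => rw [map_zero]; exact Submodule.zero_mem _
        | add x y _ _ hx hy => rw [map_add]; exact Submodule.add_mem _ hx hy
        | smul c x _ hx =>
          rw [map_smul, ← algebraMap_smul S]
          exact Submodule.smul_mem _ _ hx
      have h₄ : ∀ u ∈ N, comp d u ∈ LinearMap.range π := by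
        intro u hu
        refine Submodule.smul_induction_on hu (fun r hr n _ => ?_) fun x y hx hy => ?_
        · induction hr using Submodule.span_induction generalizing n with
          | mem x h =>
            obtain ⟨i, rfl⟩ := h
            cases d with
            | zero => rw [hzero]; exact Submodule.zero_mem _
            | succ d =>
              rw [hsucc]
              exact Submodule.smul_mem _ _ (ih d (Nat.lt_succ_self d) n)
          | zero => rw [zero_smul, map_zero]; exact Submodule.zero_mem _
          | add x y _ _ hx hy =>
            rw [add_smul, map_add]
            exact Submodule.add_mem _ (hx n trivial) (hy n trivial)
          | smul a x _ hx =>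
            rw [smul_eq_mul, mul_comm, mul_smul]
            exact hx _ trivial
        · rw [map_add]
          exact Submodule.add_mem _ hx hy
      have := Submodule.add_mem _ (h₃ p hp) (h₄ _ h₂)
      rwa [← map_add, add_sub_cancel, hsame] at this
  have hπ : Function.Surjective π := by
    intro w
    have h : Submodule.span K H ≤ (LinearMap.range π).restrictScalars K := by
      refine Submodule.span_le.2 fun x hx => ?_
      obtain ⟨d, w, rfl⟩ := Set.mem_iUnion.1 hx
      exact hsurj d w
    exact h (hsum w)
  obtain ⟨s, hs⟩ := Module.projective_lifting_property π LinearMap.id hπ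
  have hI : ∀ g, π g = 0 → ∀ y, g y ∈ I := by
    intro g hg y
    have h₁ : g.sum (fun y r => constantCoeff r • (y : M ⧸ N)) = 0 := by
      have : N.mkQ (π g) = 0 := by rw [hg, map_zero]
      rw [Finsupp.linearCombination_apply, map_finsuppSum] at this
      rw [← this]
      refine Finsupp.sum_congr fun y _ => ?_
      rw [hmk, ← hv y]
      rfl
    have h₂ := linearIndependent_iff'.1 hbli g.support (fun y => constantCoeff (g y)) h₁ y
    by_cases hy : y ∈ g.support
    · exact (mem_span_X_iff _).2 (h₂ hy)
    · rw [Finsupp.notMem_support_iff.1 hy]; exact Ideal.zero_mem _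
  -- With `s` a section of `π`, an element `g` of the kernel is `∑ g_y (e_y - s (v_y))`. The
  -- brackets lie in the kernel and the `g_y` lie in `I`, so the kernel equals `I` times itself.
  -- Krull's intersection theorem then forces it to vanish.
  have hIn : ∀ n g, π g = 0 → ∀ y, g y ∈ I ^ n := by
    intro n
    induction n with
    | zero => simp
    | succ n ih =>
      intro g hg y
      have h₁ : g = g.sum fun y r => r • (Finsupp.single y 1 - s (v y)) := by
        have h₂ : (g.sum fun y r => r • s (v y)) = 0 := by
          rw [← map_zero s, ← hg, Finsupp.linearCombination_apply, map_finsuppSum]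
          simp only [map_smul]
        simp only [smul_sub, Finsupp.sum_sub, h₂, Finsupp.smul_single, smul_eq_mul, mul_one,
          Finsupp.sum_single, sub_zero]
      rw [h₁, Finsupp.sum_apply, pow_succ']
      refine Ideal.sum_mem _ fun y' _ => ?_
      refine Ideal.mul_mem_mul (hI g hg y') (ih _ ?_ y)
      rw [map_sub, ← LinearMap.comp_apply, hs]
      simp [π]
  have hinj : Function.Injective π := by
    rw [injective_iff_map_eq_zero]
    intro g hg
    ext1 y
    have h : g y ∈ (⨅ n, I ^ n : Ideal S) := (Submodule.mem_iInf _).2 fun n => hIn n g hg y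
    rw [Ideal.iInf_pow_eq_bot_of_isDomain] at h
    · exact h
    · rw [Ne, Ideal.eq_top_iff_one, mem_span_X_iff]
      simp
  exact Module.Free.of_equiv (LinearEquiv.ofBijective π ⟨hinj, hπ⟩)

end GradedProjective

/-! ### Operators preserving an ideal as a module, and their symbols -/

section Pres

variable {K σ ι₁ ι₂ : Type*} [Field K]

/-- The operators of order `m` that preserve `(Q)`. -/
def presOps (Q : MvPolynomial σ K) (m : ℕ) :
    Submodule (MvPolynomial σ K) (Module.End K (MvPolynomial σ K)) where
  carrier := {θ | θ ∈ diffOps K σ m ∧ Preserves Q θ}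
  zero_mem' := ⟨Submodule.zero_mem _, fun g => by simp⟩
  add_mem' hθ hη := ⟨Submodule.add_mem _ hθ.1 hη.1, hθ.2.add hη.2⟩
  smul_mem' f _ hθ := ⟨Submodule.smul_mem _ f hθ.1, fun g => (hθ.2 g).mul_left f⟩

theorem symOp_mem_presOps {Q : MvPolynomial σ K} {m : ℕ} {F : MvPolynomial (σ ⊕ σ) K}
    (hF : F ∈ symPres Q m) : symOp F ∈ presOps Q m :=
  ⟨mem_diffOps_iff.2 ⟨F, hF.1, rfl⟩, hF.2⟩

theorem rename_mul_mem_symPres {Q : MvPolynomial σ K} {m : ℕ} {F : MvPolynomial (σ ⊕ σ) K}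
    (f : MvPolynomial σ K) (hF : F ∈ symPres Q m) : rename Sum.inl f * F ∈ symPres Q m := by
  refine ⟨?_, fun g => ?_⟩
  · have h0 : IsWeightedHomogeneous (orderWeight σ) (rename Sum.inl f) 0 := by
      refine isWeightedHomogeneous_rename _ fun d _ => ?_
      simp [Finsupp.weight_apply, orderWeight]
    simpa using h0.mul hF.1
  · rw [symOp_rename_inl_mul]
    exact (hF.2 g).mul_left f

variable [CharZero K]

/-- Operators and symbols correspond. -/
def symEquiv (Q : MvPolynomial σ K) (m : ℕ) : symPres Q m ≃ₗ[K] presOps Q m :=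
  LinearEquiv.ofBijective
    { toFun := fun F => ⟨symOp F.1, symOp_mem_presOps F.2⟩
      map_add' := fun F G => Subtype.ext (map_add symOp _ _)
      map_smul' := fun c F => Subtype.ext (map_smul symOp c _) }
    ⟨fun F G h => Subtype.ext (symOp_injective (congrArg Subtype.val h)), fun θ => by
      obtain ⟨F, hF, hθ⟩ := mem_diffOps_iff.1 θ.2.1
      exact ⟨⟨F, hF, hθ ▸ θ.2.2⟩, Subtype.ext hθ⟩⟩

/-- The symbol of an operator preserving `(Q)`. -/
def sym {Q : MvPolynomial σ K} {m : ℕ} : presOps Q m →ₗ[K] MvPolynomial (σ ⊕ σ) K :=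
  (symPres Q m).subtype ∘ₗ (symEquiv Q m).symm.toLinearMap

theorem sym_mem {Q : MvPolynomial σ K} {m : ℕ} (θ : presOps Q m) : sym θ ∈ symPres Q m :=
  ((symEquiv Q m).symm θ).2

theorem symOp_sym {Q : MvPolynomial σ K} {m : ℕ} (θ : presOps Q m) : symOp (sym θ) = θ.1 :=
  congrArg Subtype.val ((symEquiv Q m).apply_symm_apply θ)

theorem sym_smul {Q : MvPolynomial σ K} {m : ℕ} (f : MvPolynomial σ K) (θ : presOps Q m) :
    sym (f • θ) = rename Sum.inl f * sym θ := by
  apply symOp_injective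
  rw [symOp_sym, symOp_rename_inl_mul, symOp_sym]
  rfl

theorem sym_mk {Q : MvPolynomial σ K} {m : ℕ} {F : MvPolynomial (σ ⊕ σ) K} (hF : F ∈ symPres Q m) :
    sym (⟨symOp F, symOp_mem_presOps hF⟩ : presOps Q m) = F :=
  symOp_injective (symOp_sym _)

theorem sym_injective {Q : MvPolynomial σ K} {m : ℕ} :
    Function.Injective (sym : presOps Q m → _) := by
  intro θ η h
  apply Subtype.ext
  rw [← symOp_sym, h, symOp_sym]

end Pres

/-! ### The grading by coefficient degree -/

section Graded

variable {K σ : Type*} [Field K]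

theorem weightedHomogeneousComponent_monomial (W : σ → ℕ) (d : ℕ) (w : σ →₀ ℕ) (c : K) :
    weightedHomogeneousComponent W d (monomial w c) =
      if Finsupp.weight W w = d then monomial w c else 0 := by
  classical
  rw [weightedHomogeneousComponent_of_mem (isWeightedHomogeneous_monomial W w c rfl)]
  simp only [eq_comm]

theorem dvd_homogeneousComponent {Q f : MvPolynomial σ K} {n : ℕ} (hQ : Q.IsHomogeneous n)
    (h : Q ∣ f) (k : ℕ) : Q ∣ homogeneousComponent k f := by
  obtain ⟨g, rfl⟩ := h
  rw [← sum_homogeneousComponent g, Finset.mul_sum, map_sum]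
  refine Finset.dvd_sum fun j _ => ?_
  rw [homogeneousComponent_of_mem (hQ.mul (homogeneousComponent_isHomogeneous j g))]
  split_ifs
  · exact dvd_mul_right _ _
  · exact dvd_zero _

/-- All terms of `F` have the same order `m`, so on a form of degree `n` the degree of the output
determines the coefficient degree of the term. For `n < m` both sides are zero. -/
theorem symOp_weightedHomogeneousComponent {F : MvPolynomial (σ ⊕ σ) K} {m n : ℕ}
    (hF : IsWeightedHomogeneous (orderWeight σ) F m) {f : MvPolynomial σ K}
    (hf : f.IsHomogeneous n) (d : ℕ) :
    symOp (weightedHomogeneousComponent (degreeWeight σ) d F) f =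
      homogeneousComponent (d + (n - m)) (symOp F f) := by
  rw [F.as_sum]
  simp only [map_sum, LinearMap.sum_apply]
  refine Finset.sum_congr rfl fun w hw => ?_
  have hw := hF (mem_support_iff.1 hw)
  have h := isHomogeneous_symOp (isWeightedHomogeneous_monomial (orderWeight σ) w (coeff w F) hw)
    (isWeightedHomogeneous_monomial (degreeWeight σ) w (coeff w F) rfl) hf
  rw [homogeneousComponent_of_mem h, weightedHomogeneousComponent_monomial]
  by_cases hd : Finsupp.weight (degreeWeight σ) w = d
  · rw [if_pos hd, if_pos (by omega)]
  · rw [if_neg hd, if_neg (by omega), map_zero, LinearMap.zero_apply]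

/-- Since `Q` is homogeneous, so is the ideal `(Q)`. On forms in `(Q)` the component of the operator
yields a homogeneous component of a value in `(Q)`. -/
theorem weightedHomogeneousComponent_mem_symPres {Q : MvPolynomial σ K} {n m : ℕ}
    (hQ : Q.IsHomogeneous n) {F : MvPolynomial (σ ⊕ σ) K} (hF : F ∈ symPres Q m) (d : ℕ) :
    weightedHomogeneousComponent (degreeWeight σ) d F ∈ symPres Q m := by
  classical
  refine ⟨fun w hw => hF.1 (d := w) fun h => hw ?_, fun g => ?_⟩
  · rw [coeff_weightedHomogeneousComponent, h, ite_self]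
  · rw [← sum_homogeneousComponent g, Finset.mul_sum, map_sum]
    refine Finset.dvd_sum fun j _ => ?_
    rw [symOp_weightedHomogeneousComponent hF.1
      (hQ.mul (homogeneousComponent_isHomogeneous j g))]
    exact dvd_homogeneousComponent hQ (hF.2 _) _

theorem weightedHomogeneousComponent_X_mul (i : σ) (F : MvPolynomial (σ ⊕ σ) K) (d : ℕ) :
    weightedHomogeneousComponent (degreeWeight σ) d (X (Sum.inl i) * F) =
      if d = 0 then 0 else
        X (Sum.inl i) * weightedHomogeneousComponent (degreeWeight σ) (d - 1) F := by
  induction F using MvPolynomial.induction_on' with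
  | add p q hp hq =>
    rw [mul_add, map_add, hp, hq, map_add]
    split_ifs
    · simp
    · rw [mul_add]
  | monomial w c =>
    have h : Finsupp.weight (degreeWeight σ) (Finsupp.single (Sum.inl i) 1 + w) =
        1 + Finsupp.weight (degreeWeight σ) w := by
      rw [map_add, Finsupp.weight_single]
      simp [degreeWeight]
    rw [X, monomial_mul, weightedHomogeneousComponent_monomial,
      weightedHomogeneousComponent_monomial, h]
    by_cases hd : d = 0
    · rw [if_pos hd, if_neg (by omega)]
    · rw [if_neg hd]
      by_cases hw : Finsupp.weight (degreeWeight σ) w = d - 1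
      · rw [if_pos hw, if_pos (by omega), monomial_mul]
      · rw [if_neg hw, if_neg (by omega), mul_zero]

theorem presOps_free_of_projective [CharZero K] [Finite σ] {Q : MvPolynomial σ K} {n m : ℕ}
    (hQ : Q.IsHomogeneous n) [Module.Projective (MvPolynomial σ K) (presOps Q m)] :
    Module.Free (MvPolynomial σ K) (presOps Q m) := by
  classical
  let comp (d : ℕ) : presOps Q m →ₗ[K] presOps Q m :=
    (symEquiv Q m).toLinearMap ∘ₗ
      ((weightedHomogeneousComponent (degreeWeight σ) d).restrict
        fun F hF => weightedHomogeneousComponent_mem_symPres hQ hF d) ∘ₗ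
        (symEquiv Q m).symm.toLinearMap
  have hcomp : ∀ d θ, sym (comp d θ) = weightedHomogeneousComponent (degreeWeight σ) d (sym θ) := by
    intro d θ
    simp [comp, sym]
  refine free_of_projective_of_graded (K := K) (M := presOps Q m) comp (fun θ => ?_) (fun d θ => ?_) (fun d d' θ h => ?_)
    (fun i θ => ?_) (fun d i θ => ?_)
  · have h : θ = ∑ d ∈ (weightedHomogeneousComponent_finsupp (w := degreeWeight σ)
        (sym θ)).toFinset, comp d θ := by
      apply sym_injective
      rw [map_sum]
      simp only [hcomp]
      rw [← finsum_eq_sum _ (weightedHomogeneousComponent_finsupp (sym θ)),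
        sum_weightedHomogeneousComponent]
    rw [h]
    exact Submodule.sum_mem _ fun d _ =>
      Submodule.subset_span (Set.mem_iUnion.2 ⟨d, _, rfl⟩)
  · apply sym_injective
    rw [hcomp, hcomp, IsWeightedHomogeneous.weightedHomogeneousComponent_same
      (weightedHomogeneousComponent_isWeightedHomogeneous _ _)]
  · apply sym_injective
    rw [hcomp, hcomp, IsWeightedHomogeneous.weightedHomogeneousComponent_ne _
      (weightedHomogeneousComponent_isWeightedHomogeneous _ _) h, map_zero]
  · apply sym_injective
    rw [hcomp, sym_smul, rename_X, weightedHomogeneousComponent_X_mul, if_pos rfl, map_zero]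
  · apply sym_injective
    rw [hcomp, sym_smul, sym_smul, rename_X, weightedHomogeneousComponent_X_mul,
      if_neg (Nat.succ_ne_zero d), hcomp]
    rfl

end Graded

/-! ### From the product to a factor -/

section Retract

/-- `N` is free over `S` and `S` is free over `R`, so `N` is free over `R` and `M` is a direct
summand of it. -/
theorem projective_of_retract {R S M N : Type*} [CommRing R] [CommRing S] [Algebra R S]
    [Module.Free R S] [AddCommGroup M] [Module R M] [AddCommGroup N] [Module S N]
    [Module.Free S N] (i : M →+ N) (r : N →+ M) (hi : ∀ a x, i (a • x) = algebraMap R S a • i x)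
    (hr : ∀ a x, r (algebraMap R S a • x) = a • r x) (hri : ∀ x, r (i x) = x) :
    Module.Projective R M := by
  let : Module R N := Module.compHom N (algebraMap R S)
  have : IsScalarTower R S N := ⟨fun a s n => by
    rw [Algebra.smul_def, mul_smul]; rfl⟩
  have : Module.Free R N := Module.Free.trans (S := S)
  exact Module.Projective.of_split
    { i with map_smul' := hi } { r with map_smul' := hr } (LinearMap.ext hri)

variable {K σ ι₁ ι₂ : Type*} [Field K]

theorem free_rename_left (e : ι₁ ⊕ ι₂ ≃ σ) :
    letI := (rename (R := K) (e ∘ Sum.inl)).toRingHom.toAlgebra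
    Module.Free (MvPolynomial ι₁ K) (MvPolynomial σ K) := by
  let := (rename (R := K) (e ∘ Sum.inl)).toRingHom.toAlgebra
  let E : TensorProduct K (MvPolynomial ι₁ K) (MvPolynomial ι₂ K) ≃ₗ[MvPolynomial ι₁ K]
      MvPolynomial σ K :=
    { (splitEquiv K e).toAddEquiv with
      map_smul' := fun p t => by
        change splitEquiv K e (p • t) = rename (e ∘ Sum.inl) p * splitEquiv K e t
        induction t using TensorProduct.induction_on with
        | zero => rw [smul_zero, map_zero, mul_zero]
        | tmul a b =>
          rw [TensorProduct.smul_tmul', smul_eq_mul, splitEquiv_tmul, splitEquiv_tmul,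
            ← pair_one_right, pair_mul_pair, one_mul]
        | add x y hx hy => rw [smul_add, map_add, hx, hy, map_add, mul_add] }
  exact Module.Free.of_equiv E

theorem exists_mem_symPres_ne_zero [Nonempty σ] {Q : MvPolynomial σ K} (hQ : Q ≠ 0) (m : ℕ) :
    ∃ G ∈ symPres Q m, G ≠ 0 := by
  obtain ⟨i⟩ := ‹Nonempty σ›
  -- The operator `Q ∂_i^m` has all its values in `(Q)`; its existence is where positive dimension
  -- enters.
  refine ⟨rename Sum.inl Q * X (Sum.inr i) ^ m, ⟨?_, fun g => ?_⟩, ?_⟩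
  · have h0 : IsWeightedHomogeneous (orderWeight σ) (rename Sum.inl Q) 0 := by
      refine isWeightedHomogeneous_rename _ fun d _ => ?_
      simp [Finsupp.weight_apply, orderWeight]
    have h1 := (isWeightedHomogeneous_X K (orderWeight σ) (Sum.inr i)).pow m
    simpa [orderWeight] using h0.mul h1
  · rw [symOp_rename_inl_mul]
    exact dvd_mul_right _ _
  · refine mul_ne_zero ?_ (pow_ne_zero _ (X_ne_zero _))
    exact (map_ne_zero_iff _ (rename_injective _ Sum.inl_injective)).2 hQ

/-- Multiplication by a fixed symbol `G` of order `m - i` is split by the coefficient at an exponent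
`c` where `G` does not vanish, divided by `coeff c G`. As `c` has order `m - i`, that coefficient of
a symbol of order `m` has order `i`. -/
theorem presOps_projective_of_free_pair [CharZero K] [Nonempty ι₂] (e : ι₁ ⊕ ι₂ ≃ σ)
    {Q₁ : MvPolynomial ι₁ K} {Q₂ : MvPolynomial ι₂ K} (hQ₂ : Q₂ ≠ 0) {i m : ℕ} (him : i ≤ m)
    [Module.Free (MvPolynomial σ K) (presOps (pair e Q₁ Q₂) m)] :
    Module.Projective (MvPolynomial ι₁ K) (presOps Q₁ i) := by
  obtain ⟨G, hG, hG0⟩ := exists_mem_symPres_ne_zero hQ₂ (m - i)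
  obtain ⟨c, hc⟩ := exists_coeff_ne_zero hG0
  have hci : i + Finsupp.weight (orderWeight ι₂) c = m := by rw [hG.1 hc]; omega
  have hmem : ∀ F ∈ symPres Q₁ i, pair (symSplit e) F G ∈ symPres (pair e Q₁ Q₂) m := by
    intro F hF
    have := pair_mem_symPres e hF hG
    rwa [show i + (m - i) = m by omega] at this
  let := (rename (R := K) (e ∘ Sum.inl)).toRingHom.toAlgebra
  have := free_rename_left (K := K) e
  have hren : ∀ p : MvPolynomial ι₁ K, (rename Sum.inl (rename (e ∘ Sum.inl) p) :
      MvPolynomial (σ ⊕ σ) K) = rename (symSplit e ∘ Sum.inl) (rename Sum.inl p) := by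
    intro p
    rw [rename_rename, rename_rename]
    rfl
  refine projective_of_retract (S := MvPolynomial σ K) (N := presOps (pair e Q₁ Q₂) m)
    (AddMonoidHom.mk' (fun θ => ⟨symOp (pair (symSplit e) (sym θ) G),
      symOp_mem_presOps (hmem _ (sym_mem θ))⟩) fun θ η => ?_)
    (AddMonoidHom.mk' (fun θ => ⟨symOp ((coeff c G)⁻¹ • coeffRight (symSplit e) c (sym θ)),
      symOp_mem_presOps (Submodule.smul_mem _ _
        (coeffRight_mem_symPres e hQ₂ (sym_mem θ) hci))⟩) fun θ η => ?_)
    (fun p θ => ?_) (fun p θ => ?_) (fun θ => ?_)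
  · apply Subtype.ext
    simp
  · apply Subtype.ext
    simp
  · apply Subtype.ext
    change symOp (pair (symSplit e) (sym (p • θ)) G) =
      rename (e ∘ Sum.inl) p • symOp (pair (symSplit e) (sym θ) G)
    rw [sym_smul, ← symOp_rename_inl_mul, pair_apply, pair_apply, map_mul (rename _), hren,
      mul_assoc]
  · apply Subtype.ext
    change symOp ((coeff c G)⁻¹ • coeffRight (symSplit e) c (sym (rename (e ∘ Sum.inl) p • θ))) =
      p • symOp ((coeff c G)⁻¹ • coeffRight (symSplit e) c (sym θ))
    rw [sym_smul, hren, coeffRight_rename_mul, ← symOp_rename_inl_mul, mul_smul_comm]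
  · apply sym_injective
    change sym (⟨symOp _, _⟩ : presOps Q₁ i) = _
    rw [sym_mk (Submodule.smul_mem _ _ (coeffRight_mem_symPres e hQ₂ (sym_mem _) hci))]
    change (coeff c G)⁻¹ • coeffRight (symSplit e) c (sym (⟨symOp _, _⟩ : presOps _ m)) = _
    rw [sym_mk (hmem _ (sym_mem θ)), coeffRight_pair, smul_smul, inv_mul_cancel₀ hc, one_smul]

end Retract

/-! ### From the factors to the product: a basis of products -/

section FreePair

theorem linearIndependent_sigma_of_projections {R M η : Type*} {κ : η → Type*} [CommRing R]
    [AddCommGroup M] [Module R M] {f : ∀ i, κ i → M} (hf : ∀ i, LinearIndependent R (f i))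
    (π : η → M →ₗ[R] M) (hsame : ∀ i k, π i (f i k) = f i k)
    (hne : ∀ i j k, i ≠ j → π j (f i k) = 0) :
    LinearIndependent R fun p : Σ i, κ i => f p.1 p.2 := by
  rw [linearIndependent_iff]
  intro l hl
  have h : ∀ j, π j ∘ₗ Finsupp.linearCombination R (fun p : Σ i, κ i => f p.1 p.2) =
      Finsupp.linearCombination R (f j) ∘ₗ
        Finsupp.lcomapDomain (R := R) (M := R) (Sigma.mk j) sigma_mk_injective := by
    classical
    intro j
    ext ⟨i, k⟩
    by_cases hij : i = j
    · subst hij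
      have : Finsupp.comapDomain (Sigma.mk i) (Finsupp.single (⟨i, k⟩ : Σ i, κ i) (1 : R))
          sigma_mk_injective.injOn = Finsupp.single k 1 := by
        ext k'
        simp [Finsupp.single_apply]
      simp [Finsupp.lcomapDomain, this, hsame]
    · have : Finsupp.comapDomain (Sigma.mk j) (Finsupp.single (⟨i, k⟩ : Σ i, κ i) (1 : R))
          sigma_mk_injective.injOn = 0 := by
        ext k'
        simp [hij]
      simp [Finsupp.lcomapDomain, this, hne i j k hij]
  ext ⟨j, k⟩
  have h₁ := DFunLike.congr_fun (h j) l
  rw [LinearMap.comp_apply, hl, map_zero, LinearMap.comp_apply] at h₁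
  exact DFunLike.congr_fun (linearIndependent_iff.1 (hf j) _ h₁.symm) k

variable {K σ ι₁ ι₂ : Type*} [Field K]

/-- Expanding the coefficients of a relation into monomials turns it into a relation over `K`, where
tensor products preserve independence. -/
theorem linearIndependent_of_monomial_smul {M κ : Type*} [AddCommGroup M] [Module K M]
    [Module (MvPolynomial σ K) M] [IsScalarTower K (MvPolynomial σ K) M] {v : κ → M}
    (h : LinearIndependent K fun p : (σ →₀ ℕ) × κ =>
      (monomial p.1 (1 : K) : MvPolynomial σ K) • v p.2) :
    LinearIndependent (MvPolynomial σ K) v := by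
  classical
  rw [linearIndependent_iff']
  intro s g hg i hi
  let t := s.biUnion fun i => (g i).support
  have h₁ : ∑ p ∈ t ×ˢ s, coeff p.1 (g p.2) • (monomial p.1 (1 : K) : MvPolynomial σ K) • v p.2 =
      0 := by
    rw [Finset.sum_product_right, ← hg]
    refine Finset.sum_congr rfl fun j hj => ?_
    have : g j = ∑ d ∈ t, coeff d (g j) • (monomial d (1 : K) : MvPolynomial σ K) := by
      conv_lhs => rw [(g j).as_sum]
      simp only [smul_monomial, smul_eq_mul, mul_one]
      refine Finset.sum_subset (Finset.subset_biUnion_of_mem (fun i => (g i).support) hj) ?_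
      intro d _ hd
      rw [notMem_support_iff.1 hd, map_zero]
    conv_rhs => rw [this, Finset.sum_smul]
    simp only [smul_assoc]
  ext d
  by_cases hd : d ∈ t
  · exact linearIndependent_iff'.1 h _ (fun p => coeff p.1 (g p.2)) h₁ (d, i)
      (Finset.mem_product.2 ⟨hd, hi⟩)
  · exact notMem_support_iff.1 fun h' => hd (Finset.mem_biUnion.2 ⟨i, hi, h'⟩)

theorem symOp_pair_rename_mul (e : ι₁ ⊕ ι₂ ≃ σ) (p : MvPolynomial ι₁ K) (q : MvPolynomial ι₂ K)
    (F : MvPolynomial (ι₁ ⊕ ι₁) K) (G : MvPolynomial (ι₂ ⊕ ι₂) K) :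
    symOp (pair (symSplit e) (rename Sum.inl p * F) (rename Sum.inl q * G)) =
      pair e p q • symOp (pair (symSplit e) F G) := by
  have h : pair (symSplit e) (rename Sum.inl p) (rename Sum.inl q) =
      rename Sum.inl (pair e p q) := by
    simp only [pair_apply, map_mul, rename_rename]
    rfl
  rw [← pair_mul_pair, h, symOp_rename_inl_mul]

theorem linearIndependent_coe_iff {R M κ : Type*} [CommRing R] [AddCommGroup M] [Module R M]
    (N : Submodule R M) {v : κ → N} :
    LinearIndependent R (fun k => (v k : M)) ↔ LinearIndependent R v :=
  LinearMap.linearIndependent_iff N.subtype N.ker_subtype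

theorem linearIndependent_monomial_smul {M κ : Type*} [AddCommGroup M] [Module K M]
    [Module (MvPolynomial σ K) M] [IsScalarTower K (MvPolynomial σ K) M] {v : κ → M}
    (h : LinearIndependent (MvPolynomial σ K) v) :
    LinearIndependent K fun p : (σ →₀ ℕ) × κ =>
      (monomial p.1 (1 : K) : MvPolynomial σ K) • v p.2 := by
  have h₁ := linearIndependent_smul (basisMonomials σ K).linearIndependent h
  rwa [coe_basisMonomials] at h₁

theorem linearIndependent_monomial_mul_sym [CharZero K] {Q : MvPolynomial σ K} {m : ℕ}
    {κ : Type*} (B : Module.Basis κ (MvPolynomial σ K) (presOps Q m)) :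
    LinearIndependent K fun p : (σ →₀ ℕ) × κ =>
      rename Sum.inl (monomial p.1 (1 : K)) * sym (B p.2) := by
  have h₁ := linearIndependent_monomial_smul
    ((linearIndependent_coe_iff (presOps Q m)).2 B.linearIndependent)
  have h₂ : (fun p : (σ →₀ ℕ) × κ => (monomial p.1 (1 : K) : MvPolynomial σ K) • (B p.2).1) =
      symOp ∘ fun p : (σ →₀ ℕ) × κ => rename Sum.inl (monomial p.1 (1 : K)) * sym (B p.2) := by
    ext1 p
    rw [Function.comp_apply, symOp_rename_inl_mul, symOp_sym]
  rw [h₂] at h₁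
  exact LinearIndependent.of_comp symOp h₁

section Basis

variable [CharZero K] (e : ι₁ ⊕ ι₂ ≃ σ) {Q₁ : MvPolynomial ι₁ K} {Q₂ : MvPolynomial ι₂ K} {m : ℕ}
  {κ₁ κ₂ : Fin (m + 1) → Type*}
  (B₁ : ∀ i : Fin (m + 1), Module.Basis (κ₁ i) (MvPolynomial ι₁ K) (presOps Q₁ i))
  (B₂ : ∀ i : Fin (m + 1), Module.Basis (κ₂ i) (MvPolynomial ι₂ K) (presOps Q₂ (m - i)))

theorem pair_sym_mem (i : Fin (m + 1)) (θ : presOps Q₁ i) (η : presOps Q₂ (m - i)) :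
    pair (symSplit e) (sym θ) (sym η) ∈ symPres (pair e Q₁ Q₂) m := by
  have := pair_mem_symPres e (sym_mem θ) (sym_mem η)
  rwa [show (i : ℕ) + (m - i) = m by omega] at this

/-- The products of elements of bases for the two factors. -/
def pairFamily (p : Σ i, κ₁ i × κ₂ i) : presOps (pair e Q₁ Q₂) m :=
  ⟨_, symOp_mem_presOps (pair_sym_mem e p.1 (B₁ p.1 p.2.1) (B₂ p.1 p.2.2))⟩

theorem span_pairFamily (hQ₁ : Q₁ ≠ 0) (hQ₂ : Q₂ ≠ 0) :
    ⊤ ≤ Submodule.span (MvPolynomial σ K) (Set.range (pairFamily e B₁ B₂)) := by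
  let L := Submodule.span (MvPolynomial σ K) (Set.range (pairFamily e B₁ B₂))
  -- Products of arbitrary elements reduce to products of basis elements by linearity in each
  -- factor; `symPres_pair` says that such products exhaust the module.
  have hL : ∀ (i : Fin (m + 1)) (θ : presOps Q₁ i) (η : presOps Q₂ (m - i)),
      symOp (pair (symSplit e) (sym θ) (sym η)) ∈ L.map (presOps (pair e Q₁ Q₂) m).subtype := by
    intro i θ η
    have hθ : θ ∈ Submodule.span (MvPolynomial ι₁ K) (Set.range (B₁ i)) := by
      rw [(B₁ i).span_eq]; trivial
    have hη : η ∈ Submodule.span (MvPolynomial ι₂ K) (Set.range (B₂ i)) := by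
      rw [(B₂ i).span_eq]; trivial
    induction hθ using Submodule.span_induction with
    | zero => simp
    | add x y _ _ hx hy =>
      simp only [map_add, LinearMap.add_apply]
      exact Submodule.add_mem _ hx hy
    | smul f x _ hx =>
      have := symOp_pair_rename_mul e f 1 (sym x) (sym η)
      rw [map_one, one_mul] at this
      rw [sym_smul, this]
      exact Submodule.smul_mem _ _ hx
    | mem x h =>
      obtain ⟨k, rfl⟩ := h
      induction hη using Submodule.span_induction with
      | zero => simp
      | add x y _ _ hx hy =>
        simp only [map_add]
        exact Submodule.add_mem _ hx hy
      | smul f x _ hx =>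
        have := symOp_pair_rename_mul e 1 f (sym (B₁ i k)) (sym x)
        rw [map_one, one_mul] at this
        rw [sym_smul, this]
        exact Submodule.smul_mem _ _ hx
      | mem x h =>
        obtain ⟨l, rfl⟩ := h
        exact ⟨pairFamily e B₁ B₂ ⟨i, k, l⟩, Submodule.subset_span ⟨_, rfl⟩, rfl⟩
  have hle : symPres (pair e Q₁ Q₂) m ≤
      ((L.map (presOps (pair e Q₁ Q₂) m).subtype).restrictScalars K).comap symOp := by
    rw [symPres_pair e hQ₁ hQ₂]
    refine iSup_le fun i => Submodule.map₂_le.2 fun F hF G hG => ?_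
    have := hL i ⟨_, symOp_mem_presOps hF⟩ ⟨_, symOp_mem_presOps hG⟩
    rw [sym_mk hF, sym_mk hG] at this
    exact this
  intro θ _
  obtain ⟨η, hη, h⟩ := hle (sym_mem θ)
  rw [symOp_sym] at h
  rwa [← show η = θ from Subtype.ext h]

theorem pairFamily_eq (p : Σ i, κ₁ i × κ₂ i) : (pairFamily e B₁ B₂ p).1 =
    symOp (pair (symSplit e) (sym (B₁ p.1 p.2.1)) (sym (B₂ p.1 p.2.2))) := rfl

/-- The family of symbols whose linear independence over `K` amounts to that of `pairFamily` over
the polynomial ring. -/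
def pairMonomialFamily (i : Fin (m + 1)) (p : ((ι₁ →₀ ℕ) × κ₁ i) × ((ι₂ →₀ ℕ) × κ₂ i)) :
    MvPolynomial (σ ⊕ σ) K :=
  pair (symSplit e) (rename Sum.inl (monomial p.1.1 (1 : K)) * sym (B₁ i p.1.2))
    (rename Sum.inl (monomial p.2.1 (1 : K)) * sym (B₂ i p.2.2))

theorem symOp_pairMonomialFamily (i : Fin (m + 1))
    (p : ((ι₁ →₀ ℕ) × κ₁ i) × ((ι₂ →₀ ℕ) × κ₂ i)) :
    symOp (pairMonomialFamily e B₁ B₂ i p) =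
      (monomial (p.1.1.mapDomain (e ∘ Sum.inl) + p.2.1.mapDomain (e ∘ Sum.inr)) (1 : K) :
        MvPolynomial σ K) • (pairFamily e B₁ B₂ ⟨i, p.1.2, p.2.2⟩).1 := by
  rw [pairMonomialFamily, symOp_pair_rename_mul, pair_monomial, one_mul, pairFamily_eq]

theorem linearIndependent_pairMonomialFamily (i : Fin (m + 1)) :
    LinearIndependent K (pairMonomialFamily e B₁ B₂ i) := by
  have h := pair_linearIndependent (symSplit e) (linearIndependent_monomial_mul_sym (B₁ i))
    (linearIndependent_monomial_mul_sym (B₂ i))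
  have h' : pairMonomialFamily e B₁ B₂ i = fun p => pair (symSplit e)
      (rename Sum.inl (monomial p.1.1 (1 : K)) * sym (B₁ i p.1.2))
      (rename Sum.inl (monomial p.2.1 (1 : K)) * sym (B₂ i p.2.2)) := by
    ext1 p
    rw [pairMonomialFamily]
  rw [h']
  exact h

theorem linearIndependent_sigma_pairMonomialFamily :
    LinearIndependent K fun p : Σ i, ((ι₁ →₀ ℕ) × κ₁ i) × ((ι₂ →₀ ℕ) × κ₂ i) =>
      pairMonomialFamily e B₁ B₂ p.1 p.2 := by
  -- This weight counts only the order in the first variables, so its homogeneous components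
  -- separate the blocks for different `i`.
  let W : σ ⊕ σ → ℕ := Sum.elim (orderWeight ι₁) 0 ∘ (symSplit e).symm
  have hW₁ : W ∘ symSplit e ∘ Sum.inl = orderWeight ι₁ := by
    ext j; simp [W]
  have hW₂ : W ∘ symSplit e ∘ Sum.inr = 0 := by
    ext j; simp [W]
  have hW (i : Fin (m + 1)) (F G) (hF : F ∈ symPres Q₁ i) :
      IsWeightedHomogeneous W (pair (symSplit e) F G) i := by
    refine isWeightedHomogeneous_pair (j := 0) (symSplit e) ?_ ?_
    · rw [hW₁]; exact hF.1
    · rw [hW₂]; intro d _; simp [Finsupp.weight_apply]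
  have h (i : Fin (m + 1)) (p) :
      IsWeightedHomogeneous W (pairMonomialFamily e B₁ B₂ i p) i :=
    hW i _ _ (rename_mul_mem_symPres _ (sym_mem _))
  exact linearIndependent_sigma_of_projections (linearIndependent_pairMonomialFamily e B₁ B₂)
    (fun i => weightedHomogeneousComponent W i)
    (fun i p => (h i p).weightedHomogeneousComponent_same)
    (fun i j p hij => (h i p).weightedHomogeneousComponent_ne _ fun h => hij (Fin.ext h.symm))

theorem exists_mapDomain_add_mapDomain {α β γ : Type*} (e : α ⊕ β ≃ γ) (w : γ →₀ ℕ) :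
    ∃ (d : α →₀ ℕ) (c : β →₀ ℕ),
      d.mapDomain (e ∘ Sum.inl) + c.mapDomain (e ∘ Sum.inr) = w := by
  refine ⟨(Finsupp.sumFinsuppAddEquivProdFinsupp (w.equivMapDomain e.symm)).1,
    (Finsupp.sumFinsuppAddEquivProdFinsupp (w.equivMapDomain e.symm)).2, ?_⟩
  ext s
  obtain ⟨j | j, rfl⟩ := e.surjective s
  · rw [show e (Sum.inl j) = (e ∘ Sum.inl) j from rfl, Finsupp.add_apply, Finsupp.mapDomain_apply (e.injective.comp Sum.inl_injective),
      Finsupp.mapDomain_of_notMem_range _ _ (by simp)]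
    simp
  · rw [show e (Sum.inr j) = (e ∘ Sum.inr) j from rfl, Finsupp.add_apply, Finsupp.mapDomain_apply (e.injective.comp Sum.inr_injective),
      Finsupp.mapDomain_of_notMem_range _ _ (by simp)]
    simp

theorem linearIndependent_pairFamily :
    LinearIndependent (MvPolynomial σ K) (pairFamily e B₁ B₂) := by
  -- Each monomial of the large ring splits into monomials of the two small rings, so monomial
  -- multiples of `pairFamily` are images of distinct members of the independent family of symbols.
  choose wl wr hw using exists_mapDomain_add_mapDomain e
  have h₁ := (linearIndependent_sigma_pairMonomialFamily e B₁ B₂).map' symOp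
    (LinearMap.ker_eq_bot.2 symOp_injective)
  have hinj : Function.Injective fun p : (σ →₀ ℕ) × (Σ i, κ₁ i × κ₂ i) =>
      (⟨p.2.1, ((wl p.1, p.2.2.1), (wr p.1, p.2.2.2))⟩ :
        Σ i, ((ι₁ →₀ ℕ) × κ₁ i) × ((ι₂ →₀ ℕ) × κ₂ i)) := by
    rintro ⟨w, i, k, l⟩ ⟨w', i', k', l'⟩ h
    obtain ⟨rfl, h⟩ := Sigma.mk.inj h
    simp only [heq_eq_eq, Prod.mk.injEq] at h
    obtain ⟨⟨h1, rfl⟩, h2, rfl⟩ := h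
    rw [← hw w, h1, h2, hw]
  have h₂ : LinearIndependent (MvPolynomial σ K) fun p => (pairFamily e B₁ B₂ p).1 := by
    refine linearIndependent_of_monomial_smul (K := K) ?_
    have h₃ : (fun p : (σ →₀ ℕ) × (Σ i, κ₁ i × κ₂ i) =>
        (monomial p.1 (1 : K) : MvPolynomial σ K) • (pairFamily e B₁ B₂ p.2).1) =
        (symOp ∘ fun p : Σ i, ((ι₁ →₀ ℕ) × κ₁ i) × ((ι₂ →₀ ℕ) × κ₂ i) =>
          pairMonomialFamily e B₁ B₂ p.1 p.2) ∘ fun p : (σ →₀ ℕ) × (Σ i, κ₁ i × κ₂ i) =>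
          ⟨p.2.1, ((wl p.1, p.2.2.1), (wr p.1, p.2.2.2))⟩ := by
      ext1 p
      rw [Function.comp_apply, Function.comp_apply, symOp_pairMonomialFamily, hw]
    rw [h₃]
    exact h₁.comp _ hinj
  exact (linearIndependent_coe_iff _).1 h₂

end Basis

theorem presOps_pair_free [CharZero K] (e : ι₁ ⊕ ι₂ ≃ σ) {Q₁ : MvPolynomial ι₁ K}
    {Q₂ : MvPolynomial ι₂ K} (hQ₁ : Q₁ ≠ 0) (hQ₂ : Q₂ ≠ 0) {m : ℕ}
    (h₁ : ∀ i ≤ m, Module.Free (MvPolynomial ι₁ K) (presOps Q₁ i))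
    (h₂ : ∀ i ≤ m, Module.Free (MvPolynomial ι₂ K) (presOps Q₂ i)) :
    Module.Free (MvPolynomial σ K) (presOps (pair e Q₁ Q₂) m) := by
  have h₁ (i : Fin (m + 1)) := h₁ i (by omega)
  have h₂ (i : Fin (m + 1)) := h₂ (m - i) (by omega)
  exact Module.Free.of_basis (Module.Basis.mk
    (linearIndependent_pairFamily e (fun i => (h₁ i).chooseBasis) fun i => (h₂ i).chooseBasis)
    (span_pairFamily e _ _ hQ₁ hQ₂))

end FreePair

/-! ### Independence of coordinates -/

section ChangeOfBasis

variable {K W ι ι' : Type*} [Field K] [AddCommGroup W] [Module K W]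

/-- The linear polynomial of a vector with respect to a basis. -/
def linForm (x : Module.Basis ι K W) : W →ₗ[K] MvPolynomial ι K :=
  x.constr K fun i => (X i : MvPolynomial ι K)

theorem linForm_basis (x : Module.Basis ι K W) (i : ι) : linForm x (x i) = X i := by
  rw [linForm, Module.Basis.constr_basis]

theorem linForm_injective (x : Module.Basis ι K W) : Function.Injective (linForm x) := by
  intro v w h
  simp only [linForm, Module.Basis.constr_apply] at h
  exact x.repr.injective (linearIndependent_X ι K h)

theorem linForm_isHomogeneous (x : Module.Basis ι K W) (w : W) : (linForm x w).IsHomogeneous 1 := by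
  rw [linForm, Module.Basis.constr_apply]
  exact Submodule.sum_mem (homogeneousSubmodule ι K 1) fun i _ =>
    Submodule.smul_mem _ _ (isHomogeneous_X K i)

theorem partialOp_linForm (x : Module.Basis ι K W) (i : ι) (w : W) :
    partialOp K i (linForm x w) = C (x.repr w i) := by
  classical
  have h : partialOp K i ∘ₗ linForm x =
      (Algebra.linearMap K (MvPolynomial ι K)) ∘ₗ Finsupp.lapply i ∘ₗ x.repr.toLinearMap := by
    refine x.ext fun j => ?_
    simp only [LinearMap.comp_apply, linForm_basis]
    simp [partialOp, pderiv_X, Pi.single_apply, Finsupp.single_apply]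
  exact DFunLike.congr_fun h w

/-- The linear change of coordinates between two bases. -/
def coordHom (x : Module.Basis ι K W) (x' : Module.Basis ι' K W) :
    MvPolynomial ι K →ₐ[K] MvPolynomial ι' K :=
  aeval fun i => linForm x' (x i)

theorem coordHom_linForm (x : Module.Basis ι K W) (x' : Module.Basis ι' K W) (w : W) :
    coordHom x x' (linForm x w) = linForm x' w := by
  have h : (coordHom x x').toLinearMap ∘ₗ linForm x = linForm x' := by
    refine x.ext fun j => ?_
    simp [linForm_basis, coordHom]
  exact DFunLike.congr_fun h w

theorem coordHom_comp (x : Module.Basis ι K W) (x' : Module.Basis ι' K W) :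
    (coordHom x' x).comp (coordHom x x') = AlgHom.id K _ := by
  ext1 i
  rw [AlgHom.comp_apply, ← linForm_basis x, coordHom_linForm, coordHom_linForm]
  rfl

/-- The linear change of coordinates between two bases, as an isomorphism. -/
def coordEquiv (x : Module.Basis ι K W) (x' : Module.Basis ι' K W) :
    MvPolynomial ι K ≃ₐ[K] MvPolynomial ι' K :=
  AlgEquiv.ofAlgHom (coordHom x x') (coordHom x' x) (coordHom_comp x' x) (coordHom_comp x x')

theorem coordEquiv_linForm (x : Module.Basis ι K W) (x' : Module.Basis ι' K W) (w : W) :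
    coordEquiv x x' (linForm x w) = linForm x' w := coordHom_linForm x x' w

/-- Conjugation of operators by a change of coordinates. -/
def conjOp (x : Module.Basis ι K W) (x' : Module.Basis ι' K W) :
    Module.End K (MvPolynomial ι K) ≃ₐ[K] Module.End K (MvPolynomial ι' K) :=
  (coordEquiv x x').toLinearEquiv.conjAlgEquiv K

theorem conjOp_apply (x : Module.Basis ι K W) (x' : Module.Basis ι' K W)
    (θ : Module.End K (MvPolynomial ι K)) (f : MvPolynomial ι' K) :
    conjOp x x' θ f = coordEquiv x x' (θ (coordEquiv x' x f)) := rfl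

theorem conjOp_smul (x : Module.Basis ι K W) (x' : Module.Basis ι' K W) (f : MvPolynomial ι K)
    (θ : Module.End K (MvPolynomial ι K)) :
    conjOp x x' (f • θ) = coordEquiv x x' f • conjOp x x' θ := by
  refine LinearMap.ext fun g => ?_
  rw [conjOp_apply, LinearMap.smul_apply, LinearMap.smul_apply, smul_eq_mul, smul_eq_mul, map_mul,
    conjOp_apply]

theorem conjOp_conjOp (x : Module.Basis ι K W) (x' : Module.Basis ι' K W)
    (θ : Module.End K (MvPolynomial ι K)) : conjOp x' x (conjOp x x' θ) = θ := by
  refine LinearMap.ext fun g => ?_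
  have h : ∀ f, coordEquiv x' x (coordEquiv x x' f) = f := fun f =>
    (coordEquiv x x').symm_apply_apply f
  rw [conjOp_apply, conjOp_apply, h, h]

/-- The constant coefficient operators of order `m`. -/
def constOps (K ι : Type*) [Field K] (m : ℕ) : Submodule K (Module.End K (MvPolynomial ι K)) :=
  Submodule.span K {θ | ∃ a : ι →₀ ℕ, a.degree = m ∧ θ = partialPow K a}

theorem mul_mem_constOps {m n : ℕ} {θ η : Module.End K (MvPolynomial ι K)}
    (hθ : θ ∈ constOps K ι m) (hη : η ∈ constOps K ι n) : θ * η ∈ constOps K ι (m + n) := by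
  have h := Submodule.mul_mem_mul hθ hη
  rw [constOps, constOps, Submodule.span_mul_span] at h
  refine Submodule.span_mono ?_ h
  rintro _ ⟨_, ⟨a, rfl, rfl⟩, _, ⟨b, rfl, rfl⟩, rfl⟩
  exact ⟨a + b, map_add _ _ _, (partialPow_add a b).symm⟩

theorem constOps_le_diffOps {m : ℕ} {θ : Module.End K (MvPolynomial ι K)}
    (hθ : θ ∈ constOps K ι m) : θ ∈ diffOps K ι m := by
  have h : constOps K ι m ≤ (diffOps K ι m).restrictScalars K :=
    Submodule.span_le.2 fun θ hθ => Submodule.subset_span hθ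
  exact h hθ

theorem conjOp_partialOp [Finite ι'] (x : Module.Basis ι K W) (x' : Module.Basis ι' K W) (i : ι) :
    conjOp x x' (partialOp K i) ∈ constOps K ι' 1 := by
  classical
  have := Fintype.ofFinite ι'
  -- The conjugate of `∂_i` is again a derivation, hence determined by its values on the variables,
  -- which are constants as the change of coordinates is linear.
  let D : Derivation K (MvPolynomial ι' K) (MvPolynomial ι' K) :=
    Derivation.mk' (conjOp x x' (partialOp K i)) fun f g => by
      have h : ∀ f, coordEquiv x x' (coordEquiv x' x f) = f := fun f =>
        (coordEquiv x' x).symm_apply_apply f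
      simp only [conjOp_apply, map_mul, partialOp, Derivation.coeFn_coe, Derivation.leibniz,
        smul_eq_mul, map_add, h]
  have hsum : ∀ f, (∑ j, x.repr (x' j) i • pderiv j :
      Derivation K (MvPolynomial ι' K) (MvPolynomial ι' K)) f =
      ∑ j, x.repr (x' j) i • pderiv j f := by
    intro f
    have h := congrFun (map_sum Derivation.coeFnAddMonoidHom (fun j => x.repr (x' j) i •
      (pderiv j : Derivation K (MvPolynomial ι' K) (MvPolynomial ι' K))) Finset.univ) f
    rw [Finset.sum_apply] at h
    exact h
  have h : D = ∑ j, x.repr (x' j) i • pderiv j := by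
    refine derivation_ext fun j => ?_
    have h₁ : D (X j) = C (x.repr (x' j) i) := by
      change conjOp x x' (partialOp K i) (X j) = _
      rw [conjOp_apply, ← linForm_basis x', coordEquiv_linForm, partialOp_linForm]
      exact (coordEquiv x x').commutes _
    rw [h₁, hsum]
    simp only [pderiv_X, Pi.single_apply]
    simp [← C_mul']
  have h' : conjOp x x' (partialOp K i) = ∑ j, x.repr (x' j) i • partialOp K j := by
    refine LinearMap.ext fun f => ?_
    have h₁ := DFunLike.congr_fun h f
    rw [hsum] at h₁
    rw [LinearMap.sum_apply]
    exact h₁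
  rw [h']
  exact Submodule.sum_mem _ fun j _ => Submodule.smul_mem _ _
    (Submodule.subset_span ⟨Finsupp.single j 1, by simp, (partialPow_single j).symm⟩)

theorem conjOp_partialPow [Finite ι'] (x : Module.Basis ι K W) (x' : Module.Basis ι' K W)
    (a : ι →₀ ℕ) : conjOp x x' (partialPow K a) ∈ constOps K ι' a.degree := by
  have h0 : conjOp x x' 1 ∈ constOps K ι' 0 := by
    rw [map_one]
    exact Submodule.subset_span ⟨0, by simp, partialPow_zero.symm⟩
  induction a using Finsupp.induction_linear with
  | zero => simpa using h0
  | add a b ha hb =>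
    rw [partialPow_add, map_mul, map_add]
    exact mul_mem_constOps ha hb
  | single i n =>
    induction n with
    | zero => simpa using h0
    | succ n ih =>
      rw [Finsupp.single_add, partialPow_add, partialPow_single, map_mul, map_add,
        Finsupp.degree_single i 1]
      exact mul_mem_constOps ih (conjOp_partialOp x x' i)

theorem conjOp_mem_diffOps [Finite ι'] (x : Module.Basis ι K W) (x' : Module.Basis ι' K W)
    {m : ℕ} {θ : Module.End K (MvPolynomial ι K)} (hθ : θ ∈ diffOps K ι m) :
    conjOp x x' θ ∈ diffOps K ι' m := by
  induction hθ using Submodule.span_induction with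
  | mem θ h =>
    obtain ⟨a, rfl, rfl⟩ := h
    exact constOps_le_diffOps (conjOp_partialPow x x' a)
  | zero => rw [map_zero]; exact Submodule.zero_mem _
  | add θ η _ _ hθ hη => rw [map_add]; exact Submodule.add_mem _ hθ hη
  | smul f θ _ hθ => rw [conjOp_smul]; exact Submodule.smul_mem _ _ hθ

theorem conjOp_mem_presOps [Finite ι'] (x : Module.Basis ι K W) (x' : Module.Basis ι' K W)
    {Q : MvPolynomial ι K} {m : ℕ} {θ : Module.End K (MvPolynomial ι K)} (hθ : θ ∈ presOps Q m) :
    conjOp x x' θ ∈ presOps (coordEquiv x x' Q) m := by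
  refine ⟨conjOp_mem_diffOps x x' hθ.1, fun g => ?_⟩
  have h : coordEquiv x' x (coordEquiv x x' Q) = Q := (coordEquiv x x').symm_apply_apply Q
  rw [conjOp_apply, map_mul, h]
  exact map_dvd (coordEquiv x x') (hθ.2 _)

theorem presOps_free_of_coord [Finite ι] [Finite ι'] (x : Module.Basis ι K W)
    (x' : Module.Basis ι' K W) {Q : MvPolynomial ι K} {Q' : MvPolynomial ι' K} {m : ℕ}
    (hQ : coordEquiv x x' Q = Q') (h : Module.Free (MvPolynomial ι K) (presOps Q m)) :
    Module.Free (MvPolynomial ι' K) (presOps Q' m) := by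
  have hQ' : coordEquiv x' x Q' = Q := by
    rw [← hQ]; exact (coordEquiv x x').symm_apply_apply Q
  have := RingHomInvPair.of_ringEquiv (coordEquiv x x').toRingEquiv
  have := RingHomInvPair.of_ringEquiv_symm (coordEquiv x x').toRingEquiv
  let E : presOps Q m ≃ₛₗ[((coordEquiv x x').toRingEquiv :
      MvPolynomial ι K →+* MvPolynomial ι' K)] presOps Q' m :=
    { toFun := fun θ => ⟨conjOp x x' θ, hQ ▸ conjOp_mem_presOps x x' θ.2⟩
      invFun := fun θ => ⟨conjOp x' x θ, hQ' ▸ conjOp_mem_presOps x' x θ.2⟩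
      map_add' := fun θ η => Subtype.ext (map_add (conjOp x x') _ _)
      map_smul' := fun f θ => Subtype.ext (conjOp_smul x x' f θ)
      left_inv := fun θ => Subtype.ext (conjOp_conjOp x x' θ)
      right_inv := fun θ => Subtype.ext (conjOp_conjOp x' x θ) }
  exact Module.Free.of_equiv E

/-- Operators of order zero are multiplications by polynomials, and all of them preserve `(Q)`: the
module is free of rank one. -/
theorem presOps_zero_free (Q : MvPolynomial ι K) :
    Module.Free (MvPolynomial ι K) (presOps Q 0) := by
  have h1 : (1 : Module.End K (MvPolynomial ι K)) ∈ presOps Q 0 :=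
    ⟨Submodule.subset_span ⟨0, by simp, partialPow_zero.symm⟩, fun g => dvd_mul_right _ _⟩
  refine Module.Free.of_equiv (LinearEquiv.ofBijective
    (LinearMap.toSpanSingleton (MvPolynomial ι K) (presOps Q 0) ⟨1, h1⟩) ⟨fun f g h => ?_, ?_⟩)
  · have h₁ := DFunLike.congr_fun (congrArg Subtype.val h) (1 : MvPolynomial ι K)
    simpa using h₁
  · rintro ⟨θ, hθ⟩
    have h₂ : {θ | ∃ a : ι →₀ ℕ, a.degree = 0 ∧ θ = partialPow K a} =
        {(1 : Module.End K (MvPolynomial ι K))} := by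
      ext η
      constructor
      · rintro ⟨a, ha, rfl⟩
        rw [Finsupp.degree_eq_zero_iff] at ha
        rw [ha, partialPow_zero]
        rfl
      · rintro rfl
        exact ⟨0, by simp, partialPow_zero.symm⟩
    have h₃ := hθ.1
    rw [diffOps, h₂, Submodule.mem_span_singleton] at h₃
    obtain ⟨f, rfl⟩ := h₃
    exact ⟨f, rfl⟩

theorem presOps_C_mul {c : K} (hc : c ≠ 0) (Q : MvPolynomial ι K) (m : ℕ) :
    presOps (C c * Q) m = presOps Q m := by
  have h : ∀ f, C c * Q ∣ f ↔ Q ∣ f := fun f =>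
    IsUnit.mul_left_dvd (IsUnit.map C hc.isUnit)
  have h' : ∀ (θ : Module.End K (MvPolynomial ι K)) g, θ (C c * Q * g) = C c * θ (Q * g) := by
    intro θ g
    rw [mul_assoc, C_mul', C_mul', map_smul]
  have h'' : ∀ f, Q ∣ C c * f ↔ Q ∣ f := fun f =>
    IsUnit.dvd_mul_left (IsUnit.map C hc.isUnit)
  ext θ
  refine and_congr Iff.rfl (forall_congr' fun g => ?_)
  rw [h, h', h'']

end ChangeOfBasis

/-! ### Defining polynomials of arrangements and products -/

section Arrangement

variable {K V ι : Type*} [Field K] [AddCommGroup V] [Module K V]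

theorem exists_eq_smul_of_ker_eq {f g : Module.Dual K V} (h : LinearMap.ker f = LinearMap.ker g)
    (hf : f ≠ 0) : ∃ c : K, c ≠ 0 ∧ f = c • g := by
  have h₁ : f ∈ Submodule.span K (Set.range fun _ : Unit => g) :=
    mem_span_of_iInf_ker_le_ker (by simp [h])
  rw [Set.range_const, Submodule.mem_span_singleton] at h₁
  obtain ⟨c, rfl⟩ := h₁
  exact ⟨c, fun hc => hf (by rw [hc, zero_smul]), rfl⟩

theorem definingForm_ne_zero {H : Submodule K V} (hH : IsCoatom H) : definingForm H ≠ 0 := by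
  intro h
  have := ker_definingForm hH
  rw [h, LinearMap.ker_zero] at this
  exact hH.1 this.symm

namespace CentralArrangement

theorem diffOps_eq_presOps (A : CentralArrangement K V) (x : Module.Basis ι K (Module.Dual K V))
    (m : ℕ) : A.diffOps x m = presOps (A.definingPolynomial x) m := by
  ext θ
  refine and_congr Iff.rfl ⟨fun h g => ?_, fun h g hg => ?_⟩
  · exact Ideal.mem_span_singleton.1 (h _ (Ideal.mem_span_singleton.2 (dvd_mul_right _ _)))
  · obtain ⟨g, rfl⟩ := Ideal.mem_span_singleton.1 hg
    exact Ideal.mem_span_singleton.2 (h g)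

theorem definingPolynomial_eq (A : CentralArrangement K V)
    (x : Module.Basis ι K (Module.Dual K V)) :
    A.definingPolynomial x = ∏ H ∈ A.hyperplanes, linForm x (definingForm H) := rfl

theorem definingPolynomial_ne_zero (A : CentralArrangement K V)
    (x : Module.Basis ι K (Module.Dual K V)) : A.definingPolynomial x ≠ 0 := by
  rw [definingPolynomial_eq]
  refine Finset.prod_ne_zero_iff.2 fun H hH => ?_
  exact (map_ne_zero_iff _ (linForm_injective x)).2 (definingForm_ne_zero (A.isCoatom H hH))

theorem definingPolynomial_isHomogeneous (A : CentralArrangement K V)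
    (x : Module.Basis ι K (Module.Dual K V)) :
    (A.definingPolynomial x).IsHomogeneous (∑ _H ∈ A.hyperplanes, 1) := by
  rw [definingPolynomial_eq]
  exact IsHomogeneous.prod _ _ _ fun H _ => linForm_isHomogeneous x _

theorem coordEquiv_definingPolynomial {ι' : Type*} (A : CentralArrangement K V)
    (x : Module.Basis ι K (Module.Dual K V)) (x' : Module.Basis ι' K (Module.Dual K V)) :
    coordEquiv x x' (A.definingPolynomial x) = A.definingPolynomial x' := by
  rw [definingPolynomial_eq, definingPolynomial_eq, map_prod]
  simp only [coordEquiv_linForm]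

theorem isMFree_iff (A : CentralArrangement K V) (x : Module.Basis ι K (Module.Dual K V)) (m : ℕ) :
    A.IsMFree x m ↔ Module.Free (MvPolynomial ι K) (presOps (A.definingPolynomial x) m) := by
  rw [IsMFree, diffOps_eq_presOps]

theorem isMFree_congr {ι' : Type*} [Finite ι] [Finite ι'] (A : CentralArrangement K V)
    (x : Module.Basis ι K (Module.Dual K V)) (x' : Module.Basis ι' K (Module.Dual K V)) (m : ℕ) :
    A.IsMFree x m ↔ A.IsMFree x' m := by
  rw [isMFree_iff, isMFree_iff]
  exact ⟨presOps_free_of_coord x x' (A.coordEquiv_definingPolynomial x x'),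
    presOps_free_of_coord x' x (A.coordEquiv_definingPolynomial x' x)⟩

variable {V₁ V₂ ι₁ ι₂ : Type*} [AddCommGroup V₁] [Module K V₁] [AddCommGroup V₂] [Module K V₂]

/-- The basis of the dual of a product of two spaces obtained from bases of the duals. -/
def dualProdBasis (x₁ : Module.Basis ι₁ K (Module.Dual K V₁))
    (x₂ : Module.Basis ι₂ K (Module.Dual K V₂)) :
    Module.Basis (ι₁ ⊕ ι₂) K (Module.Dual K (V₁ × V₂)) :=
  (x₁.prod x₂).map (Module.dualProdDualEquivDual K V₁ V₂)

theorem linForm_comp_fst (x₁ : Module.Basis ι₁ K (Module.Dual K V₁))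
    (x₂ : Module.Basis ι₂ K (Module.Dual K V₂)) (f : Module.Dual K V₁) :
    linForm (dualProdBasis x₁ x₂) (f ∘ₗ LinearMap.fst K V₁ V₂) =
      rename Sum.inl (linForm x₁ f) := by
  have h : linForm (dualProdBasis x₁ x₂) ∘ₗ
      LinearMap.lcomp K K (LinearMap.fst K V₁ V₂) =
      (rename Sum.inl).toLinearMap ∘ₗ linForm x₁ := by
    refine x₁.ext fun i => ?_
    have hi : x₁ i ∘ₗ LinearMap.fst K V₁ V₂ = dualProdBasis x₁ x₂ (Sum.inl i) := by
      refine LinearMap.ext fun v => ?_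
      simp [dualProdBasis]
    rw [LinearMap.comp_apply, LinearMap.lcomp_apply', hi, linForm_basis, LinearMap.comp_apply,
      linForm_basis, AlgHom.toLinearMap_apply, rename_X]
  exact DFunLike.congr_fun h f

theorem linForm_comp_snd (x₁ : Module.Basis ι₁ K (Module.Dual K V₁))
    (x₂ : Module.Basis ι₂ K (Module.Dual K V₂)) (f : Module.Dual K V₂) :
    linForm (dualProdBasis x₁ x₂) (f ∘ₗ LinearMap.snd K V₁ V₂) =
      rename Sum.inr (linForm x₂ f) := by
  have h : linForm (dualProdBasis x₁ x₂) ∘ₗ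
      LinearMap.lcomp K K (LinearMap.snd K V₁ V₂) =
      (rename Sum.inr).toLinearMap ∘ₗ linForm x₂ := by
    refine x₂.ext fun i => ?_
    have hi : x₂ i ∘ₗ LinearMap.snd K V₁ V₂ = dualProdBasis x₁ x₂ (Sum.inr i) := by
      refine LinearMap.ext fun v => ?_
      simp [dualProdBasis]
    rw [LinearMap.comp_apply, LinearMap.lcomp_apply', hi, linForm_basis, LinearMap.comp_apply,
      linForm_basis, AlgHom.toLinearMap_apply, rename_X]
  exact DFunLike.congr_fun h f

theorem exists_definingForm_prod_top {H : Submodule K V₁} (hH : IsCoatom H) :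
    ∃ c : K, c ≠ 0 ∧ definingForm (H.prod (⊤ : Submodule K V₂)) =
      c • (definingForm H ∘ₗ LinearMap.fst K V₁ V₂) := by
  have hH' : IsCoatom (H.prod (⊤ : Submodule K V₂)) := by
    rw [← Submodule.comap_fst]
    exact (Submodule.isCoatom_comap_iff LinearMap.fst_surjective).2 hH
  refine exists_eq_smul_of_ker_eq ?_ (definingForm_ne_zero hH')
  rw [ker_definingForm hH', LinearMap.ker_comp, ker_definingForm hH, Submodule.comap_fst]

theorem exists_definingForm_top_prod {H : Submodule K V₂} (hH : IsCoatom H) :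
    ∃ c : K, c ≠ 0 ∧ definingForm ((⊤ : Submodule K V₁).prod H) =
      c • (definingForm H ∘ₗ LinearMap.snd K V₁ V₂) := by
  have hH' : IsCoatom ((⊤ : Submodule K V₁).prod H) := by
    rw [← Submodule.comap_snd]
    exact (Submodule.isCoatom_comap_iff LinearMap.snd_surjective).2 hH
  refine exists_eq_smul_of_ker_eq ?_ (definingForm_ne_zero hH')
  rw [ker_definingForm hH', LinearMap.ker_comp, ker_definingForm hH, Submodule.comap_snd]

theorem exists_prod_eq_C_mul_prod {R σ : Type*} (s : Finset R) (f g : R → MvPolynomial σ K)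
    (h : ∀ i ∈ s, ∃ c : K, c ≠ 0 ∧ f i = C c * g i) :
    ∃ c : K, c ≠ 0 ∧ ∏ i ∈ s, f i = C c * ∏ i ∈ s, g i := by
  choose! c hc hfg using h
  refine ⟨∏ i ∈ s, c i, Finset.prod_ne_zero_iff.2 hc, ?_⟩
  rw [map_prod, ← Finset.prod_mul_distrib]
  exact Finset.prod_congr rfl hfg

/-- The constant is unavoidable: the form chosen for `H ⊕ V₂` is only proportional to the pullback
of the form chosen for `H`, and likewise for the second factor. By `presOps_C_mul` it does not
matter. -/
theorem exists_definingPolynomial_prod (A₁ : CentralArrangement K V₁)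
    (A₂ : CentralArrangement K V₂) (x₁ : Module.Basis ι₁ K (Module.Dual K V₁))
    (x₂ : Module.Basis ι₂ K (Module.Dual K V₂)) :
    ∃ c : K, c ≠ 0 ∧ (A₁.prod A₂).definingPolynomial (dualProdBasis x₁ x₂) =
      C c * pair (Equiv.refl (ι₁ ⊕ ι₂)) (A₁.definingPolynomial x₁) (A₂.definingPolynomial x₂) := by
  classical
  have hinl : Function.Injective fun H : Submodule K V₁ => H.prod (⊤ : Submodule K V₂) :=
    fun H H' h => by
      ext v
      have := SetLike.ext_iff.1 h (v, 0)
      simpa using this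
  have hinr : Function.Injective fun H : Submodule K V₂ => (⊤ : Submodule K V₁).prod H :=
    fun H H' h => by
      ext v
      have := SetLike.ext_iff.1 h (0, v)
      simpa using this
  have hdisj : Disjoint (A₁.hyperplanes.image fun H => H.prod (⊤ : Submodule K V₂))
      (A₂.hyperplanes.image fun H => (⊤ : Submodule K V₁).prod H) := by
    rw [Finset.disjoint_left]
    intro L h₁ h₂
    obtain ⟨H, hH, rfl⟩ := Finset.mem_image.1 h₁
    obtain ⟨H', hH', h⟩ := Finset.mem_image.1 h₂
    -- A common hyperplane `H ⊕ V₂ = V₁ ⊕ H'` would contain all of `V₁`, forcing `H = V₁`.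
    refine (A₁.isCoatom H hH).1 (eq_top_iff.2 fun v _ => ?_)
    have := SetLike.ext_iff.1 h (v, 0)
    simpa using this
  obtain ⟨c₁, hc₁, h₁⟩ := exists_prod_eq_C_mul_prod A₁.hyperplanes
    (fun H => linForm (dualProdBasis x₁ x₂) (definingForm (H.prod (⊤ : Submodule K V₂))))
    (fun H => rename Sum.inl (linForm x₁ (definingForm H))) fun H hH => by
      obtain ⟨c, hc, h⟩ := exists_definingForm_prod_top (V₂ := V₂) (A₁.isCoatom H hH)
      exact ⟨c, hc, by rw [h, map_smul, linForm_comp_fst, C_mul']⟩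
  obtain ⟨c₂, hc₂, h₂⟩ := exists_prod_eq_C_mul_prod A₂.hyperplanes
    (fun H => linForm (dualProdBasis x₁ x₂) (definingForm ((⊤ : Submodule K V₁).prod H)))
    (fun H => rename Sum.inr (linForm x₂ (definingForm H))) fun H hH => by
      obtain ⟨c, hc, h⟩ := exists_definingForm_top_prod (V₁ := V₁) (A₂.isCoatom H hH)
      exact ⟨c, hc, by rw [h, map_smul, linForm_comp_snd, C_mul']⟩
  refine ⟨c₁ * c₂, mul_ne_zero hc₁ hc₂, ?_⟩
  have hprod : (A₁.prod A₂).hyperplanes =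
      (A₁.hyperplanes.image fun H => H.prod (⊤ : Submodule K V₂)) ∪
        A₂.hyperplanes.image fun H => (⊤ : Submodule K V₁).prod H := by
    rw [CentralArrangement.prod]
  rw [definingPolynomial_eq, hprod, Finset.prod_union hdisj, Finset.prod_image hinl.injOn,
    Finset.prod_image hinr.injOn, h₁, h₂, pair_apply, definingPolynomial_eq, definingPolynomial_eq,
    map_prod, map_prod, C_mul]
  change _ = C c₁ * C c₂ * ((∏ H ∈ A₁.hyperplanes, rename Sum.inl _) *
    ∏ H ∈ A₂.hyperplanes, rename Sum.inr _)
  ring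

end CentralArrangement

end Arrangement

end

/-! ### The equivalence -/

theorem corollary1p2 {K V₁ V₂ ι₁ ι₂ ι : Type*} [Field K] [CharZero K]
    [AddCommGroup V₁] [Module K V₁] [FiniteDimensional K V₁]
    [AddCommGroup V₂] [Module K V₂] [FiniteDimensional K V₂]
    (hV₁ : 0 < Module.finrank K V₁) (hV₂ : 0 < Module.finrank K V₂)
    (A₁ : CentralArrangement K V₁) (A₂ : CentralArrangement K V₂)
    (x₁ : Module.Basis ι₁ K (Module.Dual K V₁))
    (x₂ : Module.Basis ι₂ K (Module.Dual K V₂))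
    (x : Module.Basis ι K (Module.Dual K (V₁ × V₂)))
    (m : ℕ) :
    List.TFAE
      [(A₁.prod A₂).IsMFree x m,
       ∀ i : ℕ, 1 ≤ i → i ≤ m → A₁.IsMFree x₁ i ∧ A₂.IsMFree x₂ i,
       ∀ i : ℕ, 1 ≤ i → i ≤ m → (A₁.prod A₂).IsMFree x i] := by
  have : Finite ι₁ := Module.Finite.finite_basis x₁
  have : Finite ι₂ := Module.Finite.finite_basis x₂
  have : Finite ι := Module.Finite.finite_basis x
  have : Nontrivial V₁ := Module.nontrivial_of_finrank_pos hV₁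
  have : Nontrivial V₂ := Module.nontrivial_of_finrank_pos hV₂
  have : Nonempty ι₁ := x₁.index_nonempty
  have : Nonempty ι₂ := x₂.index_nonempty
  let e := Equiv.refl (ι₁ ⊕ ι₂)
  let Q₁ := A₁.definingPolynomial x₁
  let Q₂ := A₂.definingPolynomial x₂
  have hQ₁ : Q₁ ≠ 0 := A₁.definingPolynomial_ne_zero x₁
  have hQ₂ : Q₂ ≠ 0 := A₂.definingPolynomial_ne_zero x₂
  have hprod : ∀ i, (A₁.prod A₂).IsMFree x i ↔
      Module.Free (MvPolynomial (ι₁ ⊕ ι₂) K) (presOps (pair e Q₁ Q₂) i) := by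
    intro i
    obtain ⟨c, hc, h⟩ := A₁.exists_definingPolynomial_prod A₂ x₁ x₂
    rw [CentralArrangement.isMFree_congr _ x (CentralArrangement.dualProdBasis x₁ x₂),
      CentralArrangement.isMFree_iff, h, presOps_C_mul hc]
  have hof : ∀ n, (∀ i : ℕ, 1 ≤ i → i ≤ n → A₁.IsMFree x₁ i ∧ A₂.IsMFree x₂ i) →
      (A₁.prod A₂).IsMFree x n := by
    intro n h
    rw [hprod]
    refine presOps_pair_free e hQ₁ hQ₂ (fun i hi => ?_) fun i hi => ?_
    · rcases Nat.eq_zero_or_pos i with rfl | hi'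
      · exact presOps_zero_free _
      · exact (A₁.isMFree_iff x₁ i).1 (h i hi' hi).1
    · rcases Nat.eq_zero_or_pos i with rfl | hi'
      · exact presOps_zero_free _
      · exact (A₂.isMFree_iff x₂ i).1 (h i hi' hi).2
  tfae_have 1 → 2 := by
    intro h i _ hi
    rw [hprod] at h
    constructor
    · rw [CentralArrangement.isMFree_iff]
      have := presOps_projective_of_free_pair e (Q₁ := Q₁) hQ₂ hi
      exact presOps_free_of_projective (A₁.definingPolynomial_isHomogeneous x₁)
    · rw [CentralArrangement.isMFree_iff]
      -- Exchanging the two groups of variables reduces the second factor to the argument for the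
      -- first.
      rw [← pair_comm] at h
      have := presOps_projective_of_free_pair ((Equiv.sumComm ι₂ ι₁).trans e) (Q₁ := Q₂) hQ₁ hi
      exact presOps_free_of_projective (A₂.definingPolynomial_isHomogeneous x₂)
  tfae_have 2 → 3 := fun h i _ hi => hof i fun j hj hji => h j hj (hji.trans hi)
  tfae_have 3 → 1 := by
    intro h
    -- For `m = 0` the hypothesis is vacuous, and freeness comes from the order zero case.
    rcases Nat.eq_zero_or_pos m with rfl | hm
    · exact hof 0 fun i hi hi' => by omega
    · exact h m hm le_rfl
  tfae_finish
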